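/- **Setting.** Let $\mathcal X$ be a finite set with $D\ge 2$ elements, $k:\mathcal X\times\mathcal X\to\mathbb R$ a positive semidefinite kernel with $k(x,x')\le 1$ for all $x,x'$ and $k(x,x)>0$ for all $x$, and $\sigma_n>0$. Let $f\sim GP(0,k)$ on $\mathcal X$; evaluating $f$ at $x$ returns $y=f(x)+\varepsilon$ with i.i.d. noise $\varepsilon\sim N(0,\sigma_n^2)$ independent of $f$. For a finite sequence $A=(a_1,\dots,a_n)$ of points (repetitions allowed), put $K_A=(k(a_i,a_j))_{i,j}$, $k_A(x)=(k(a_i,x))_i$, and let $$\mu_A(x)=k_A(x)^\top (K_A+\sigma_n^2 I)^{-1}y_A,\qquad \sigma_A(x)=\sqrt{k(x,x)-k_A(x)^\top(K_A+\sigma_n^2I)^{-1}k_A(x)}$$ be the posterior mean and standard deviation after observing $y_A$ at $A$; $\sigma_A(x\mid B)$ denotes the posterior standard deviation after observations at both $A$ and $B$. **Algorithm.** Let $m\ge1$ be the batch size. In round $t=0,1,2,\dots$, let $A_t$ be the sequence of the $tm$ points evaluated so far, $\mathcal F_t$ the $\sigma$-algebra generated by these points and their observed values, and $\mu_t=\mu_{A_t}$,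 $\sigma_t=\sigma_{A_t}$. Given $\mathcal F_t$, draw $\tilde f_{t,1},\dots,\tilde f_{t,m}$ independently from the conditional law of $f$ given $\mathcal F_t$ (conditionally independently of $f$, of all the noise and of all earlier draws), put $\tilde f^*_{t,i}=\max_x\tilde f_{t,i}(x)$, and choose successively, for $i=1,\dots,m$, $$x_{t+1,i}\in\operatorname*{arg\,min}_{x\in\mathcal X}\frac{\tilde f^*_{t,i}-\mu_t(x)}{\sigma_t\big(x\mid (x_{t+1,j})_{j<i}\big)}$$ (the Regret-to-Sigma Ratio). Ties are broken by any measurable rule that uses only the data in $\mathcal F_t$, the draws made so far, and possibly extra randomness independent of $f$ and the noise (the draws being conditionally independent of this randomness too, given $\mathcal F_t$). Then all $m$ points are evaluated. **Theorem.** For every $\sigma_n>0$ there is a constant $C>0$, depending only on $\sigma_n$, such that for all $\mathcal X$, $k$, $m\ge1$, every run of the algorithm and all $T\ge1$, the cumulative regret $R_{T,m}=\sum_{t=0}^{T-1}\sum_{i=1}^m\big(\max_x f(x)-f(x_{t+1,i})\big)$ is integrable and $$\mathbb E[R_{T,m}]\le C\,\rho_m\,\sqrt{Tm\,\gamma_{Tm}}\,\sqrt{\log\big(D(Tm)^3\big)}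 .$$ Here the expectation is over $f$, the noise and the algorithm's draws; $\gamma_{n}=\max_{A}I(y_A;f_A)$ is the maximal mutual information over sequences $A$ of $n$ points; and $$\rho_m=\max_{x}\ \max_{0\le\tau<T}\ \max_{A}\ \max_{B}\ \frac{\sigma_A(x)}{\sigma_A(x\mid B)},$$ where $A$ runs over all sequences of $\tau m$ points and $B$ over all sequences of at most $m$ points. More precisely, the bound also holds with $\rho_m$ replaced by $\mathbb E[\hat\rho_m]$, where $\hat\rho_m$ is the (integrable) random variable defined by the same formula with $A$ fixed to be the sequence $A_\tau$ of points that the run actually evaluated before round $\tau$. -/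

import Mathlib

open MeasureTheory ProbabilityTheory
open scoped NNReal ENNReal

namespace BatchTS

noncomputable section

/-! ### Gaussian process prior, posterior mean and posterior standard deviation -/

/-- The law on `X → ℝ` of a Gaussian process on the finite set `X` with mean zero and
covariance `k`. -/
def gpLaw {X : Type*} [Fintype X] [DecidableEq X] (k : X → X → ℝ) : Measure (X → ℝ) :=
  (multivariateGaussian (0 : EuclideanSpace ℝ X) (Matrix.of k)).map
    (fun v : EuclideanSpace ℝ X => (fun x => v x))

/-- The law of one observation noise variable, `N(0, σₙ²)`. -/
def noiseLaw (σn : ℝ) : Measure ℝ := gaussianReal 0 (σn ^ 2).toNNReal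

/-- The covariance matrix `K_A + σₙ² I` of the noisy observations at the points `A`. -/
def gram {X ι : Type*} [DecidableEq ι] (σn : ℝ) (k : X → X → ℝ) (A : ι → X) : Matrix ι ι ℝ :=
  Matrix.of (fun i j => k (A i) (A j)) + σn ^ 2 • (1 : Matrix ι ι ℝ)

/-- Posterior mean at `x` after observing the values `y` (with noise) at the points `A`. -/
def postMean {X ι : Type*} [Fintype ι] [DecidableEq ι] (σn : ℝ) (k : X → X → ℝ)
    (A : ι → X) (y : ι → ℝ) (x : X) : ℝ :=
  (fun i => k (A i) x) ⬝ᵥ ((gram σn k A)⁻¹.mulVec y)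

/-- Posterior standard deviation at `x` after noisy observations at the points `A`
(a finite family, so a point may occur several times). -/
def postSd {X ι : Type*} [Fintype ι] [DecidableEq ι] (σn : ℝ) (k : X → X → ℝ)
    (A : ι → X) (x : X) : ℝ :=
  √(k x x - (fun i => k (A i) x) ⬝ᵥ ((gram σn k A)⁻¹.mulVec (fun i => k (A i) x)))

/-- Posterior standard deviation `σ(x ∣ B)` at `x` after observations at `A` and, additionally,
at the points `B`. -/
def postSdGiven {X ι κ : Type*} [Fintype ι] [DecidableEq ι] [Fintype κ] [DecidableEq κ]
    (σn : ℝ) (k : X → X → ℝ) (A : ι → X) (B : κ → X) (x : X) : ℝ :=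
  postSd σn k (Sum.elim A B) x

/-! ### Maximal information gain -/

/-- Mutual information of two random variables, in nats: the Kullback-Leibler divergence of
their joint law from the product of their laws. -/
def mutualInfo {Ω α β : Type*} [MeasurableSpace Ω] [MeasurableSpace α] [MeasurableSpace β]
    (P : Measure Ω) (Y : Ω → α) (Z : Ω → β) : ℝ≥0∞ :=
  InformationTheory.klDiv (P.map (fun ω => (Y ω, Z ω))) ((P.map Y).prod (P.map Z))

/-- The information gain `I(y_A; f_A)`, where `y_A = f_A + e` with `f` drawn from the prior and
`e` an independent vector of i.i.d. noise variables. -/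
def infoGain {X : Type*} [Fintype X] [DecidableEq X] (σn : ℝ) (k : X → X → ℝ)
    {n : ℕ} (A : Fin n → X) : ℝ :=
  (mutualInfo ((gpLaw k).prod (Measure.pi fun _ : Fin n => noiseLaw σn))
    (fun p => fun j => p.1 (A j) + p.2 j) (fun p => fun j => p.1 (A j))).toReal

/-- The maximal information gain `γₙ` from `n` observations (repeated points are allowed). -/
def maxInfoGain {X : Type*} [Fintype X] [DecidableEq X] (σn : ℝ) (k : X → X → ℝ) (n : ℕ) : ℝ :=
  ⨆ A : Fin n → X, infoGain σn k A

/-! ### The batch algorithm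

Rounds and batch slots are numbered from `0`: `x t ω i` is the `i`-th point of the batch that is
evaluated after `t` complete rounds, `ε ω t i` the noise of that evaluation, and `g t ω i` the
posterior sample drawn for that slot. -/

/-- The points evaluated in the first `t` rounds. -/
def design {Ω X : Type*} {m : ℕ} (x : ℕ → Ω → Fin m → X) (t : ℕ) (ω : Ω) :
    Fin t × Fin m → X :=
  fun p => x p.1 ω p.2

/-- The noisy values observed in the first `t` rounds. -/
def observed {Ω X : Type*} {m : ℕ} (f : Ω → X → ℝ) (ε : Ω → ℕ → Fin m → ℝ)
    (x : ℕ → Ω → Fin m → X) (t : ℕ) (ω : Ω) : Fin t × Fin m → ℝ :=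
  fun p => f ω (x p.1 ω p.2) + ε ω p.1 p.2

/-- The data (points and observed values) of the first `t` rounds; it generates `ℱ_t`. -/
def history {Ω X : Type*} {m : ℕ} (f : Ω → X → ℝ) (ε : Ω → ℕ → Fin m → ℝ)
    (x : ℕ → Ω → Fin m → X) (t : ℕ) (ω : Ω) : (Fin t × Fin m → X) × (Fin t × Fin m → ℝ) :=
  (design x t ω, observed f ε x t ω)

/-- The Regret-to-Sigma Ratio of the candidate `z` for slot `i` after `t` rounds:
`(max g_{t,i} - μ_t(z)) / σ_t(z ∣ points already chosen in this batch)`. -/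
def rsr {Ω X : Type*} {m : ℕ} (σn : ℝ) (k : X → X → ℝ) (f : Ω → X → ℝ)
    (ε : Ω → ℕ → Fin m → ℝ) (g : ℕ → Ω → Fin m → X → ℝ) (x : ℕ → Ω → Fin m → X)
    (t : ℕ) (i : Fin m) (ω : Ω) (z : X) : ℝ :=
  ((⨆ z', g t ω i z') - postMean σn k (design x t ω) (observed f ε x t ω) z) /
    postSdGiven σn k (design x t ω) (fun j : {j : Fin m // j < i} => x t ω j) z

/-- A run, on the probability space `(Ω, P)`, of the batch algorithm that minimizes the
Regret-to-Sigma Ratio, with batch size `m`, kernel `k` and noise variance `σn ^ 2`.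
`f` is the unknown function, `ε` the noise, `g` the Thompson-sampling draws, `x` the chosen
points, and `U` is auxiliary randomness that the algorithm may use to break ties (take a
one-point type for a deterministic rule). -/
structure IsRun {Ω X 𝒰 : Type*} [MeasurableSpace Ω] [Fintype X] [DecidableEq X]
    [MeasurableSpace X] [MeasurableSpace 𝒰] (P : Measure Ω) [IsFiniteMeasure P]
    (σn : ℝ) (k : X → X → ℝ) (m : ℕ)
    (f : Ω → X → ℝ) (ε : Ω → ℕ → Fin m → ℝ) (U : Ω → 𝒰)
    (g : ℕ → Ω → Fin m → X → ℝ) (x : ℕ → Ω → Fin m → X) : Prop where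
  measurable_f : Measurable f
  measurable_ε : Measurable ε
  measurable_U : Measurable U
  measurable_g : ∀ t, Measurable (g t)
  /-- `f` is drawn from the Gaussian process prior. -/
  law_f : P.map f = gpLaw k
  /-- The noise variables are i.i.d. `N(0, σn ^ 2)`. -/
  law_ε : ∀ t i, P.map (fun ω => ε ω t i) = noiseLaw σn
  indep_ε : iIndepFun (fun (p : ℕ × Fin m) ω => ε ω p.1 p.2) P
  /-- `f`, the noise and the tie-breaking randomness are independent. -/
  indep_f_ε : IndepFun f ε P
  indep_U : IndepFun (fun ω => (f ω, ε ω)) U P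
  /-- Conditionally on everything drawn before, the `m` samples of round `t` are independent
  draws from the conditional law of `f` given the history. -/
  draws : ∀ t, ∀ᵐ ω ∂P,
    condDistrib (g t) (fun ω' => (f ω', ε ω', U ω', fun s : Fin t => g s ω')) P
        (f ω, ε ω, U ω, fun s : Fin t => g s ω) =
      Measure.pi (fun _ : Fin m =>
        condDistrib f (history f ε x t) P (history f ε x t ω))
  /-- The batch is chosen from the history, the samples drawn so far, and `U`. -/
  nonanticipating : ∀ t, ∃ φ : 𝒰 × ((Fin t × Fin m → X) × (Fin t × Fin m → ℝ)) ×
      (Fin (t + 1) → Fin m → X → ℝ) → Fin m → X,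
    Measurable φ ∧
      ∀ ω, x t ω = φ (U ω, history f ε x t ω, fun s : Fin (t + 1) => g s ω)
  /-- Each batch point minimizes the Regret-to-Sigma Ratio. -/
  argmin : ∀ t i, ∀ᵐ ω ∂P, ∀ z : X,
    rsr σn k f ε g x t i ω (x t ω i) ≤ rsr σn k f ε g x t i ω z

/-- The cumulative batch regret `R_{T,m}`. -/
def regret {Ω X : Type*} {m : ℕ} (f : Ω → X → ℝ) (x : ℕ → Ω → Fin m → X) (T : ℕ) (ω : Ω) : ℝ :=
  ∑ t ∈ Finset.range T, ∑ i : Fin m, ((⨆ z, f ω z) - f ω (x t ω i))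

/-! ### The ratio `ρ_m` -/

/-- The set of ratios `σ_A(z) / σ_A(z ∣ B)`, where `z` is any point and `B` any family of at most
`m` further points (repetitions allowed). -/
def sdRatios {X ι : Type*} [Fintype ι] [DecidableEq ι] (σn : ℝ) (k : X → X → ℝ) (m : ℕ)
    (A : ι → X) : Set ℝ :=
  {r | ∃ z : X, ∃ j ≤ m, ∃ B : Fin j → X, r = postSd σn k A z / postSdGiven σn k A B z}

/-- `ρ_m` along the realized run: the maximum over the rounds `τ = 0, …, T - 1` of the ratios
for the points actually evaluated before round `τ`. -/
def rhoPath {Ω X : Type*} {m : ℕ} (σn : ℝ) (k : X → X → ℝ) (x : ℕ → Ω → Fin m → X)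
    (T : ℕ) (ω : Ω) : ℝ :=
  sSup {r | ∃ τ < T, r ∈ sdRatios σn k m (design x τ ω)}

/-- `ρ_m` in the worst case: the maximum over the rounds `τ = 0, …, T - 1` and over all
possible choices of the `τ * m` points evaluated before round `τ`. -/
def rho {X : Type*} (σn : ℝ) (k : X → X → ℝ) (T m : ℕ) : ℝ :=
  sSup {r | ∃ τ < T, ∃ A : Fin τ × Fin m → X, r ∈ sdRatios σn k m A}

end

end BatchTS

namespace BatchTS

noncomputable section

open scoped RealInnerProductSpace MatrixOrder

/-! ### Variational description of the posterior variance -/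

/-! Why the bound holds. Given the history, a draw has the law of `f`, so `max g` and `max f` have
the same expectation. Given the history, the chosen point depends only on the draws and the
tie-breaking randomness, hence `f - μ_t` at that point has mean zero. The expected regret is
therefore the expectation of the sum of `max g - μ_t(x)` (`integral_regret_eq`).

This sum is bounded path by path. Comparing the minimizer of the ratio with the maximizer of `g`
gives `max g - μ_t(x) ≤ σ_t(x | batch) · ρ · (β + excess)`, where the excess measures by how much
the standardized residuals of the draws leave `[-β, β]` (`sup_sub_le_of_argmin`). By Cauchy-Schwarz
and the chain rule for `log det (K_A + σₙ² I)`, the sum of the standard deviations is at most a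
constant times `√(n γ_n)` with `n = T m`, on every path (`sum_postSdGiven_le`); this factor is
deterministic and leaves the expectation. What remains is `E[ρ] β` plus an excess term. For the
excess, `ρ` is replaced by the crude bound `√(1 + m / σₙ²)`, so that no joint moment of `ρ` and the
excess is needed. At `β = √(2 log (D n³))` the Gaussian tail outweighs that bound
(`integral_rhoPath_add_excess_le`).

The probabilistic core is that an adaptive design does not disturb the Gaussian posterior. For a
fixed design `A`, the residual `f z - μ_A z` is independent of the observations at `A`, since the
two are jointly Gaussian and uncorrelated. The event that the run has used `A` is decided by those
observations and by randomness that, given them, carries no further information on `f` and the noise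
(`DependsOnlyOn`, `IsRun.dependsOnlyOn`). On that event the residual keeps its law `N(0, σ_A(z)²)`
(`restrict_map_residual`). Summing over the finitely many designs yields all statements about the
actual run. -/

/-- A positive semidefinite kernel on a finite set comes from a feature map. -/
theorem exists_featureMap {X : Type*} [Fintype X] {k : X → X → ℝ}
    (hk : (Matrix.of k).PosSemidef) :
    ∃ φ : X → EuclideanSpace ℝ X, ∀ z z', k z z' = ⟪φ z, φ z'⟫ := by
  classical
  obtain ⟨B, hB⟩ := CStarAlgebra.nonneg_iff_eq_star_mul_self.1 hk.nonneg
  refine ⟨fun z => WithLp.toLp 2 (fun i => B i z), fun z z' => ?_⟩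
  have h : k z z' = (star B * B) z z' := by rw [← hB]; rfl
  rw [h]
  simp [Matrix.mul_apply, Matrix.star_apply, PiLp.inner_apply, mul_comm]

variable {X : Type*} {ι κ : Type*} [Fintype ι] [DecidableEq ι] [Fintype κ] [DecidableEq κ]
  {σn : ℝ} {k : X → X → ℝ}

/-- The posterior variance. -/
def postVar (σn : ℝ) (k : X → X → ℝ) (A : ι → X) (x : X) : ℝ :=
  k x x - (fun i => k (A i) x) ⬝ᵥ ((gram σn k A)⁻¹.mulVec (fun i => k (A i) x))

theorem postSd_eq_sqrt (A : ι → X) (x : X) : postSd σn k A x = √(postVar σn k A x) := rfl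

/-- The mean squared error of the linear predictor of `f x` with weights `w`. -/
def predErr (σn : ℝ) (k : X → X → ℝ) (A : ι → X) (x : X) (w : ι → ℝ) : ℝ :=
  k x x - 2 * (w ⬝ᵥ fun i => k (A i) x) + w ⬝ᵥ (gram σn k A).mulVec w

section Feature

variable {H : Type*} [NormedAddCommGroup H] [InnerProductSpace ℝ H] {φ : X → H}

theorem dotProduct_gram_mulVec (hφ : ∀ z z', k z z' = ⟪φ z, φ z'⟫) (A : ι → X) (w : ι → ℝ) :
    w ⬝ᵥ (gram σn k A).mulVec w = ‖∑ i, w i • φ (A i)‖ ^ 2 + σn ^ 2 * ∑ i, w i ^ 2 := by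
  rw [← real_inner_self_eq_norm_sq, sum_inner]
  simp only [inner_sum, real_inner_smul_left, real_inner_smul_right, gram, Matrix.add_mulVec,
    dotProduct_add, Matrix.smul_mulVec, Matrix.one_mulVec, dotProduct_smul, smul_eq_mul]
  congr 1
  · simp only [dotProduct, Matrix.mulVec, Matrix.of_apply, hφ, Finset.mul_sum]
    refine Finset.sum_congr rfl fun i _ => Finset.sum_congr rfl fun j _ => by ring
  · simp [dotProduct, pow_two]

/-- In feature space the prediction error is a ridge regression objective. In this form, positivity
and the effect of dropping observations can be read off. -/
theorem predErr_eq_norm (hφ : ∀ z z', k z z' = ⟪φ z, φ z'⟫) (A : ι → X) (x : X) (w : ι → ℝ) :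
    predErr σn k A x w = ‖φ x - ∑ i, w i • φ (A i)‖ ^ 2 + σn ^ 2 * ∑ i, w i ^ 2 := by
  rw [predErr, dotProduct_gram_mulVec hφ, norm_sub_sq_real, hφ, real_inner_self_eq_norm_sq]
  have : (w ⬝ᵥ fun i => k (A i) x) = ⟪φ x, ∑ i, w i • φ (A i)⟫ := by
    simp [dotProduct, inner_sum, real_inner_smul_right, hφ, real_inner_comm]
  rw [this]
  ring

end Feature

theorem gram_posDef {ι : Type*} [DecidableEq ι] [Fintype X] (hk : (Matrix.of k).PosSemidef)
    (hσn : 0 < σn) (A : ι → X) :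
    (gram σn k A).PosDef := by
  refine Matrix.PosDef.posSemidef_add (hk.submatrix A) ?_
  exact Matrix.PosDef.smul Matrix.PosDef.one (by positivity)

theorem gram_isUnit_det [Fintype X] (hk : (Matrix.of k).PosSemidef) (hσn : 0 < σn) (A : ι → X) :
    IsUnit (gram σn k A).det :=
  (gram_posDef hk hσn A).det_pos.ne'.isUnit

theorem gram_transpose {ι : Type*} [DecidableEq ι] [Fintype X] (hk : (Matrix.of k).PosSemidef)
    (hσn : 0 < σn) (A : ι → X) :
    (gram σn k A).transpose = gram σn k A := by
  simpa using (gram_posDef hk hσn A).isHermitian.eq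

/-- The weights of the posterior mean. -/
def postWeight (σn : ℝ) (k : X → X → ℝ) (A : ι → X) (x : X) : ι → ℝ :=
  (gram σn k A)⁻¹.mulVec (fun i => k (A i) x)

theorem gram_mulVec_postWeight [Fintype X] (hk : (Matrix.of k).PosSemidef) (hσn : 0 < σn)
    (A : ι → X) (x : X) :
    (gram σn k A).mulVec (postWeight σn k A x) = fun i => k (A i) x := by
  rw [postWeight, Matrix.mulVec_mulVec, Matrix.mul_nonsing_inv _ (gram_isUnit_det hk hσn A),
    Matrix.one_mulVec]

theorem postMean_eq_dotProduct [Fintype X] (hk : (Matrix.of k).PosSemidef) (hσn : 0 < σn)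
    (A : ι → X) (y : ι → ℝ) (x : X) :
    postMean σn k A y x = postWeight σn k A x ⬝ᵥ y := by
  rw [postMean, postWeight, Matrix.dotProduct_mulVec, ← Matrix.mulVec_transpose,
    Matrix.transpose_nonsing_inv, gram_transpose hk hσn]

/-- Completing the square around the solution of the normal equations. The posterior variance is
thus the minimum of `predErr`, and any choice of weights bounds it from above. -/
theorem predErr_eq_postVar_add [Fintype X] (hk : (Matrix.of k).PosSemidef) (hσn : 0 < σn)
    (A : ι → X) (x : X) (w : ι → ℝ) :
    predErr σn k A x w = postVar σn k A x +
      (w - postWeight σn k A x) ⬝ᵥ (gram σn k A).mulVec (w - postWeight σn k A x) := by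
  have hsymm : postWeight σn k A x ⬝ᵥ (gram σn k A).mulVec w =
      w ⬝ᵥ (gram σn k A).mulVec (postWeight σn k A x) := by
    rw [Matrix.dotProduct_mulVec, ← Matrix.mulVec_transpose, gram_transpose hk hσn,
      dotProduct_comm]
  rw [Matrix.mulVec_sub, dotProduct_sub, sub_dotProduct, sub_dotProduct, hsymm,
    gram_mulVec_postWeight hk hσn, predErr, postVar,
    dotProduct_comm (fun i => k (A i) x) ((gram σn k A)⁻¹.mulVec _), ← postWeight]
  ring

theorem postVar_le_predErr [Fintype X] (hk : (Matrix.of k).PosSemidef) (hσn : 0 < σn)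
    (A : ι → X) (x : X) (w : ι → ℝ) : postVar σn k A x ≤ predErr σn k A x w := by
  rw [predErr_eq_postVar_add hk hσn]
  have := (gram_posDef hk hσn A).posSemidef.dotProduct_mulVec_nonneg (w - postWeight σn k A x)
  simpa using this

theorem predErr_postWeight [Fintype X] (hk : (Matrix.of k).PosSemidef) (hσn : 0 < σn)
    (A : ι → X) (x : X) : predErr σn k A x (postWeight σn k A x) = postVar σn k A x := by
  rw [predErr_eq_postVar_add hk hσn]
  simp

/-- At the optimal weights, either all weights vanish and the error is `k x x`, or the ridge penalty
is already positive. -/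
theorem postVar_pos [Fintype X] (hk : (Matrix.of k).PosSemidef) (hσn : 0 < σn)
    (A : ι → X) {x : X} (hx : 0 < k x x) : 0 < postVar σn k A x := by
  obtain ⟨φ, hφ⟩ := exists_featureMap hk
  rw [← predErr_postWeight hk hσn, predErr_eq_norm hφ]
  set w := postWeight σn k A x
  by_cases hw : w = 0
  · have : 0 < ‖φ x‖ ^ 2 := by rwa [← real_inner_self_eq_norm_sq, ← hφ]
    simpa [hw] using this
  · obtain ⟨i, hi⟩ := Function.ne_iff.1 hw
    have : 0 < ∑ i, w i ^ 2 :=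
      Finset.sum_pos' (fun _ _ => sq_nonneg _) ⟨i, Finset.mem_univ _, by
        have : w i ≠ 0 := hi
        positivity⟩
    positivity

theorem postVar_le_self [Fintype X] (hk : (Matrix.of k).PosSemidef) (hσn : 0 < σn)
    (A : ι → X) (x : X) : postVar σn k A x ≤ k x x := by
  simpa [predErr] using postVar_le_predErr hk hσn A x 0

theorem postSd_pos [Fintype X] (hk : (Matrix.of k).PosSemidef) (hσn : 0 < σn)
    (A : ι → X) {x : X} (hx : 0 < k x x) : 0 < postSd σn k A x :=
  Real.sqrt_pos.2 (postVar_pos hk hσn A hx)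

theorem postSd_sq [Fintype X] (hk : (Matrix.of k).PosSemidef) (hσn : 0 < σn)
    (A : ι → X) {x : X} (hx : 0 < k x x) : postSd σn k A x ^ 2 = postVar σn k A x :=
  Real.sq_sqrt (postVar_pos hk hσn A hx).le

/-- Adding `card κ` observations decreases the posterior variance by at most a factor
`1 + card κ / σₙ²`. -/
theorem postVar_le_mul_postVar_sumElim [Fintype X] (hk : (Matrix.of k).PosSemidef) (hσn : 0 < σn)
    (hk_le : ∀ z z', k z z' ≤ 1) (A : ι → X) (B : κ → X) (x : X) :
    postVar σn k A x ≤
      (1 + Fintype.card κ / σn ^ 2) * postVar σn k (Sum.elim A B) x := by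
  obtain ⟨φ, hφ⟩ := exists_featureMap hk
  set W := postWeight σn k (Sum.elim A B) x with hW
  rw [← predErr_postWeight hk hσn (Sum.elim A B)]
  -- The optimal weights for `A` and `B` together, with those of `B` dropped, serve as a competitor
  -- for `A` alone.
  refine (postVar_le_predErr hk hσn A x (fun i => W (Sum.inl i))).trans ?_
  rw [predErr_eq_norm hφ, predErr_eq_norm hφ, ← hW]
  simp only [Fintype.sum_sum_type, Sum.elim_inl, Sum.elim_inr]
  set a := φ x - ∑ i, W (Sum.inl i) • φ (A i) with ha
  set b := ∑ j, W (Sum.inr j) • φ (B j) with hb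
  have hab : φ x - (∑ i, W (Sum.inl i) • φ (A i) + b) = a - b := by rw [ha]; abel
  rw [hab]
  set S := ∑ i, W (Sum.inl i) ^ 2
  set Q := ∑ j, W (Sum.inr j) ^ 2
  have hS : 0 ≤ S := Finset.sum_nonneg fun _ _ => sq_nonneg _
  have hQ : 0 ≤ Q := Finset.sum_nonneg fun _ _ => sq_nonneg _
  set N : ℝ := (Fintype.card κ : ℝ)
  have hN : 0 ≤ N := Nat.cast_nonneg _
  have hbn : ‖b‖ ^ 2 ≤ N * Q := by
    have h1 : ‖b‖ ≤ ∑ j, |W (Sum.inr j)| := by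
      refine (norm_sum_le _ _).trans (Finset.sum_le_sum fun j _ => ?_)
      rw [norm_smul, Real.norm_eq_abs]
      have : ‖φ (B j)‖ ≤ 1 := by
        rw [← sq_le_one_iff₀ (norm_nonneg _), ← real_inner_self_eq_norm_sq, ← hφ]
        exact hk_le _ _
      exact mul_le_of_le_one_right (abs_nonneg _) this
    have h2 : (∑ j, |W (Sum.inr j)|) ^ 2 ≤ N * Q := by
      have := sq_sum_le_card_mul_sum_sq (s := (Finset.univ : Finset κ))
        (f := fun j => |W (Sum.inr j)|)
      simpa [sq_abs] using this
    exact (pow_le_pow_left₀ (norm_nonneg _) h1 2).trans h2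
  have hσ2 : 0 < σn ^ 2 := by positivity
  have key : σn ^ 2 * ‖a‖ ^ 2 ≤ (σn ^ 2 + N) * (‖a - b‖ ^ 2 + σn ^ 2 * Q) := by
    have h3 : ‖a‖ ≤ ‖a - b‖ + ‖b‖ := by simpa using norm_add_le (a - b) b
    have h4 : ‖a‖ ^ 2 ≤ (‖a - b‖ + ‖b‖) ^ 2 := pow_le_pow_left₀ (norm_nonneg _) h3 2
    set p := ‖a - b‖
    set q := ‖b‖
    have hp : 0 ≤ p := norm_nonneg _
    -- Young's inequality for the cross term, from `(N p - σₙ² q)² ≥ 0` divided by `N`; hence the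
    -- separate case `N = 0`. The weights are chosen so that the total factors as `(σₙ² + N)(p² +
    -- σₙ² Q)`.
    have h5 : σn ^ 2 * (2 * (p * q)) ≤ N * p ^ 2 + σn ^ 4 * Q := by
      rcases hN.eq_or_lt with h0 | h0
      · have hq : q = 0 := by
          have : q ^ 2 ≤ 0 := by rw [← h0] at hbn; simpa using hbn
          nlinarith [sq_nonneg q]
        rw [hq]; nlinarith [pow_pos hσn 4, mul_nonneg (pow_pos hσn 4).le hQ]
      · have h6 : q ^ 2 / N ≤ Q := by rw [div_le_iff₀ h0]; linarith
        have h7 : σn ^ 2 * (2 * (p * q)) ≤ N * p ^ 2 + σn ^ 4 * (q ^ 2 / N) := by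
          have : 0 ≤ (N * p - σn ^ 2 * q) ^ 2 / N := by positivity
          have e : (N * p - σn ^ 2 * q) ^ 2 / N =
              N * p ^ 2 + σn ^ 4 * (q ^ 2 / N) - σn ^ 2 * (2 * (p * q)) := by
            field_simp; ring
          linarith
        have h8 := mul_le_mul_of_nonneg_left h6 (pow_pos hσn 4).le
        linarith
    have h9 := mul_le_mul_of_nonneg_left h4 hσ2.le
    have h10 := mul_le_mul_of_nonneg_left hbn hσ2.le
    nlinarith
  have : (1 + N / σn ^ 2) = (σn ^ 2 + N) / σn ^ 2 := by field_simp
  rw [this, div_mul_eq_mul_div, le_div_iff₀ hσ2]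
  have h11 : 0 ≤ N * (σn ^ 2 * S) := by positivity
  nlinarith

theorem postSd_div_postSdGiven_le [Fintype X] (hk : (Matrix.of k).PosSemidef) (hσn : 0 < σn)
    (hk_le : ∀ z z', k z z' ≤ 1) (hk_pos : ∀ z, 0 < k z z) (A : ι → X) (B : κ → X) (x : X) :
    postSd σn k A x / postSdGiven σn k A B x ≤ √(1 + Fintype.card κ / σn ^ 2) := by
  rw [postSdGiven, div_le_iff₀ (postSd_pos hk hσn _ (hk_pos x)), postSd_eq_sqrt, postSd_eq_sqrt,
    ← Real.sqrt_mul (by positivity)]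
  exact Real.sqrt_le_sqrt (postVar_le_mul_postVar_sumElim hk hσn hk_le A B x)

/-! ### Reindexing and the determinant of the Gram matrix -/

theorem gram_comp_equiv {ι κ : Type*} [DecidableEq ι] [DecidableEq κ] (A : ι → X) (e : κ ≃ ι) :
    gram σn k (A ∘ e) = (gram σn k A).submatrix e e := by
  ext i j
  simp [gram, Matrix.one_apply]

theorem det_gram_comp_equiv (A : ι → X) (e : κ ≃ ι) :
    (gram σn k (A ∘ e)).det = (gram σn k A).det := by
  rw [gram_comp_equiv, Matrix.det_submatrix_equiv_self]

theorem postVar_comp_equiv (A : ι → X) (e : κ ≃ ι) (x : X) :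
    postVar σn k (A ∘ e) x = postVar σn k A x := by
  rw [postVar, gram_comp_equiv, Matrix.inv_submatrix_equiv, postVar]
  congr 1
  rw [show (fun i => k ((A ∘ e) i) x) = (fun i => k (A i) x) ∘ e from rfl,
    Matrix.submatrix_mulVec_equiv]
  simp [Function.comp_assoc, comp_equiv_dotProduct_comp_equiv]

theorem postSd_comp_equiv (A : ι → X) (e : κ ≃ ι) (x : X) :
    postSd σn k (A ∘ e) x = postSd σn k A x := by
  rw [postSd_eq_sqrt, postSd_eq_sqrt, postVar_comp_equiv]

/-- The Schur complement of the block of `A` is the predictive variance of a noisy observation at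
`x`. -/
theorem det_gram_sumElim_unit [Fintype X] (hk : (Matrix.of k).PosSemidef) (hσn : 0 < σn)
    (A : ι → X) (x : X) :
    (gram σn k (Sum.elim A (fun _ : Unit => x))).det =
      (gram σn k A).det * (σn ^ 2 + postVar σn k A x) := by
  have hb : gram σn k (Sum.elim A (fun _ : Unit => x)) =
      Matrix.fromBlocks (gram σn k A) (Matrix.of fun i _ => k (A i) x)
        (Matrix.of fun _ i => k x (A i)) (Matrix.of fun _ _ => k x x + σn ^ 2) := by
    ext i j
    rcases i with i | i <;> rcases j with j | j <;> simp [gram, Matrix.one_apply]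
  have hsymm : ∀ z z', k z z' = k z' z := fun z z' => by
    simpa using (hk.isHermitian.apply z' z)
  have := Matrix.invertibleOfIsUnitDet _ (gram_isUnit_det hk hσn A)
  rw [hb, Matrix.det_fromBlocks₁₁, Matrix.det_unique (n := Unit)]
  congr 1
  simp only [Matrix.sub_apply, Matrix.of_apply, Matrix.invOf_eq_nonsing_inv, postVar]
  have : ((Matrix.of fun (_ : Unit) i => k x (A i)) * (gram σn k A)⁻¹ *
      Matrix.of fun i (_ : Unit) => k (A i) x) default default =
      (fun i => k (A i) x) ⬝ᵥ ((gram σn k A)⁻¹.mulVec (fun i => k (A i) x)) := by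
    rw [Matrix.mul_assoc]
    simp only [Matrix.mul_apply, dotProduct, Matrix.mulVec, Matrix.of_apply, hsymm x]
  rw [this]
  ring

theorem det_gram_congr {A : ι → X} {B : κ → X} (e : κ ≃ ι) (h : ∀ i, A (e i) = B i) :
    (gram σn k B).det = (gram σn k A).det := by
  rw [← det_gram_comp_equiv A e, show A ∘ e = B from funext h]

theorem postVar_congr {A : ι → X} {B : κ → X} (e : κ ≃ ι) (h : ∀ i, A (e i) = B i) (x : X) :
    postVar σn k B x = postVar σn k A x := by
  rw [← postVar_comp_equiv A e, show A ∘ e = B from funext h]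

/-- Adding a batch of observations multiplies the determinant of the Gram matrix by the successive
predictive variances. -/
theorem det_gram_sumElim_fin [Fintype X] (hk : (Matrix.of k).PosSemidef) (hσn : 0 < σn)
    (A : ι → X) {m : ℕ} (b : Fin m → X) :
    (gram σn k (Sum.elim A b)).det = (gram σn k A).det *
      ∏ i, (σn ^ 2 + postVar σn k (Sum.elim A fun j : {j : Fin m // j < i} => b j) (b i)) := by
  induction m with
  | zero =>
    rw [det_gram_congr (A := A) (Equiv.sumEmpty ι (Fin 0)) (by rintro (i | i); rfl; exact i.elim0)]
    simp
  | succ m ih =>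
    -- The last batch point is split off as a one-point block, so that the Schur complement formula
    -- applies.
    have h1 : (gram σn k (Sum.elim A b)).det = (gram σn k (Sum.elim (Sum.elim A
        fun i : Fin m => b i.castSucc) (fun _ : Unit => b (Fin.last m)))).det := by
      refine (det_gram_congr (A := Sum.elim A b)
        (B := Sum.elim (Sum.elim A fun i : Fin m => b i.castSucc) (fun _ : Unit => b (Fin.last m)))
        { toFun := Sum.elim (Sum.map id Fin.castSucc) fun _ => Sum.inr (Fin.last m)
          invFun := Sum.elim (fun i => Sum.inl (Sum.inl i))
            (Fin.lastCases (Sum.inr ()) fun i => Sum.inl (Sum.inr i))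
          left_inv := ?_
          right_inv := ?_ } ?_).symm
      · rintro ((i | i) | i) <;> simp
      · rintro (i | i)
        · simp
        · cases i using Fin.lastCases <;> simp
      · rintro ((i | i) | i) <;> simp
    rw [h1, det_gram_sumElim_unit hk hσn, ih, Fin.prod_univ_castSucc, mul_assoc]
    congr 2
    · refine Finset.prod_congr rfl fun i _ => ?_
      congr 1
      -- The predecessors of `i` in `Fin m` are the predecessors of `i.castSucc` in `Fin (m + 1)`;
      -- for the last index, below, they are all of `Fin m`.
      refine postVar_congr (Equiv.sumCongr (Equiv.refl ι)
        { toFun := fun j => ⟨j.1.castSucc, Fin.castSucc_lt_castSucc_iff.2 j.2⟩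
          invFun := fun j => ⟨j.1.castPred (Fin.ne_last_of_lt j.2), by
            have h := j.2
            rw [Fin.lt_def] at h ⊢
            exact h⟩
          left_inv := fun j => rfl
          right_inv := fun j => rfl }) ?_ _
      rintro (j | j) <;> rfl
    · congr 1
      refine postVar_congr (Equiv.sumCongr (Equiv.refl ι)
        { toFun := fun j => ⟨j.castSucc, Fin.castSucc_lt_last j⟩
          invFun := fun j => j.1.castPred j.2.ne
          left_inv := fun j => rfl
          right_inv := fun j => rfl }) ?_ _
      rintro (j | j) <;> rfl

/-- The determinant of the Gram matrix of `T` batches as the product of the successive predictive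
variances. -/
theorem det_gram_batches [Fintype X] (hk : (Matrix.of k).PosSemidef) (hσn : 0 < σn) {m : ℕ}
    (b : ℕ → Fin m → X) (T : ℕ) :
    (gram σn k (fun p : Fin T × Fin m => b p.1 p.2)).det =
      ∏ t ∈ Finset.range T, ∏ i, (σn ^ 2 + postVar σn k
        (Sum.elim (fun p : Fin t × Fin m => b p.1 p.2) fun j : {j : Fin m // j < i} => b t j)
        (b t i)) := by
  induction T with
  | zero => simp
  | succ T ih =>
    rw [Finset.prod_range_succ, ← ih, ← det_gram_sumElim_fin hk hσn]
    refine (det_gram_congr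
      { toFun := Sum.elim (fun p => (p.1.castSucc, p.2)) fun i => (Fin.last T, i)
        invFun := fun p => Fin.lastCases (motive := fun _ => (Fin T × Fin m) ⊕ Fin m)
          (Sum.inr p.2) (fun t => Sum.inl (t, p.2)) p.1
        left_inv := ?_
        right_inv := ?_ } ?_).symm
    · rintro (p | i) <;> simp
    · rintro ⟨t, i⟩
      cases t using Fin.lastCases <;> simp
    · rintro (p | i) <;> simp

end

end BatchTS

namespace BatchTS

noncomputable section

/-! ### The Gaussian observation model with fixed evaluation points -/

/-- `f` is a Gaussian process and `e` an independent family of i.i.d. noise variables. -/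
structure IsGPModel {Ω X ι : Type*} [MeasurableSpace Ω] [Fintype X] [DecidableEq X]
    (P : Measure Ω) (σn : ℝ) (k : X → X → ℝ) (f : Ω → X → ℝ) (e : Ω → ι → ℝ) : Prop where
  measurable_f : Measurable f
  measurable_e : Measurable e
  law_f : P.map f = gpLaw k
  law_e : ∀ i, P.map (fun ω => e ω i) = noiseLaw σn
  indep_e : iIndepFun (fun i ω => e ω i) P
  indep : IndepFun f e P

variable {X : Type*} [Fintype X] [DecidableEq X] {k : X → X → ℝ} {σn : ℝ}

instance isGaussian_gpLaw : IsGaussian (gpLaw k) :=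
  isGaussian_map (μ := multivariateGaussian (0 : EuclideanSpace ℝ X) (Matrix.of k))
    (EuclideanSpace.equiv X ℝ).toContinuousLinearMap

instance isProbabilityMeasure_gpLaw : IsProbabilityMeasure (gpLaw k) := inferInstance

instance isGaussian_noiseLaw : IsGaussian (noiseLaw σn) := by
  unfold noiseLaw; infer_instance

instance isProbabilityMeasure_noiseLaw : IsProbabilityMeasure (noiseLaw σn) := inferInstance

theorem integral_gpLaw (z : X) : ∫ v, v z ∂(gpLaw k) = 0 := by
  rw [gpLaw, integral_map (f := fun v : X → ℝ => v z) (by fun_prop)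
    (measurable_pi_apply z).aestronglyMeasurable]
  have h := (EuclideanSpace.proj (𝕜 := ℝ) z).integral_comp_comm
    (IsGaussian.integrable_id (μ := multivariateGaussian (0 : EuclideanSpace ℝ X) (Matrix.of k)))
  simpa using h

theorem covariance_gpLaw (hk : (Matrix.of k).PosSemidef) (z z' : X) :
    cov[fun v => v z, fun v => v z'; gpLaw k] = k z z' := by
  rw [gpLaw, covariance_map_fun (measurable_pi_apply _).aestronglyMeasurable
    (measurable_pi_apply _).aestronglyMeasurable (by fun_prop)]
  exact covariance_eval_multivariateGaussian hk z z'

theorem residual_eq {X ι : Type*} [Fintype X] [Fintype ι] [DecidableEq ι] {k : X → X → ℝ}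
    (hk : (Matrix.of k).PosSemidef) (hσn : 0 < σn) (A : ι → X) (v : X → ℝ) (y : ι → ℝ) (z : X) :
    v z - postMean σn k A y z = v z - ∑ i, postWeight σn k A z i * y i := by
  rw [postMean_eq_dotProduct hk hσn]; rfl

namespace IsGPModel

variable {Ω ι : Type*} [MeasurableSpace Ω] [Fintype ι]
  {P : Measure Ω} {f : Ω → X → ℝ} {e : Ω → ι → ℝ}

theorem isProbabilityMeasure {ι : Type*} {e : Ω → ι → ℝ} (h : IsGPModel P σn k f e) :
    IsProbabilityMeasure P :=
  h.indep_e.isProbabilityMeasure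

theorem hasGaussianLaw_f {ι : Type*} {e : Ω → ι → ℝ} (h : IsGPModel P σn k f e) :
    HasGaussianLaw f P :=
  ⟨by rw [h.law_f]; infer_instance⟩

theorem hasGaussianLaw_e (h : IsGPModel P σn k f e) : HasGaussianLaw e P :=
  h.indep_e.hasGaussianLaw fun i => ⟨by rw [h.law_e]; infer_instance⟩

theorem hasGaussianLaw_pair (h : IsGPModel P σn k f e) :
    HasGaussianLaw (fun ω => (f ω, e ω)) P :=
  h.indep.hasGaussianLaw h.hasGaussianLaw_f h.hasGaussianLaw_e

theorem memLp_f {ι : Type*} {e : Ω → ι → ℝ} (h : IsGPModel P σn k f e) (z : X) : MemLp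
    (fun ω => f ω z) 2 P :=
  (h.hasGaussianLaw_f.map_fun (ContinuousLinearMap.proj (R := ℝ) z)).memLp_two

theorem memLp_e (h : IsGPModel P σn k f e) (i : ι) : MemLp (fun ω => e ω i) 2 P :=
  (h.hasGaussianLaw_e.map_fun (ContinuousLinearMap.proj (R := ℝ) i)).memLp_two

theorem integral_f {ι : Type*} {e : Ω → ι → ℝ} (h : IsGPModel P σn k f e) (z : X) :
    ∫ ω, f ω z ∂P = 0 := by
  rw [← integral_gpLaw (k := k) z, ← h.law_f, integral_map h.measurable_f.aemeasurable
    (measurable_pi_apply _).aestronglyMeasurable]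

theorem integral_e {ι : Type*} {e : Ω → ι → ℝ} (h : IsGPModel P σn k f e) (i : ι) :
    ∫ ω, e ω i ∂P = 0 := by
  have : Measurable fun ω => e ω i := (measurable_pi_apply i).comp h.measurable_e
  have h2 : ∫ y, y ∂(noiseLaw σn) = 0 := integral_id_gaussianReal
  rw [← h2, ← h.law_e i, integral_map this.aemeasurable (by fun_prop)]

theorem covariance_f {ι : Type*} {e : Ω → ι → ℝ} (h : IsGPModel P σn k f e)
    (hk : (Matrix.of k).PosSemidef) (z z' : X) :
    cov[fun ω => f ω z, fun ω => f ω z'; P] = k z z' := by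
  rw [← covariance_gpLaw hk z z', ← h.law_f,
    covariance_map_fun (measurable_pi_apply _).aestronglyMeasurable
      (measurable_pi_apply _).aestronglyMeasurable h.measurable_f.aemeasurable]

theorem covariance_e [DecidableEq ι] (h : IsGPModel P σn k f e) (i j : ι) :
    cov[fun ω => e ω i, fun ω => e ω j; P] = if i = j then σn ^ 2 else 0 := by
  split_ifs with hij
  · subst hij
    have hm : Measurable fun ω => e ω i := (measurable_pi_apply i).comp h.measurable_e
    rw [covariance_self hm.aemeasurable, ← variance_id_map hm.aemeasurable, h.law_e, noiseLaw,
      variance_id_gaussianReal, Real.coe_toNNReal _ (sq_nonneg _)]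
  · exact (h.indep_e.indepFun hij).covariance_eq_zero (h.memLp_e i) (h.memLp_e j)

theorem covariance_f_e (h : IsGPModel P σn k f e) (z : X) (i : ι) :
    cov[fun ω => f ω z, fun ω => e ω i; P] = 0 :=
  (h.indep.comp (measurable_pi_apply z) (measurable_pi_apply i)).covariance_eq_zero
    (h.memLp_f z) (h.memLp_e i)

theorem memLp_obs (h : IsGPModel P σn k f e) (A : ι → X) (i : ι) :
    MemLp (fun ω => f ω (A i) + e ω i) 2 P :=
  (h.memLp_f (A i)).add (h.memLp_e i)

theorem covariance_f_obs (h : IsGPModel P σn k f e) (hk : (Matrix.of k).PosSemidef)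
    (A : ι → X) (z : X) (i : ι) :
    cov[fun ω => f ω z, fun ω => f ω (A i) + e ω i; P] = k (A i) z := by
  have := h.isProbabilityMeasure
  have h1 := covariance_add_right (h.memLp_f z) (h.memLp_f (A i)) (h.memLp_e i)
  rw [h.covariance_f hk, h.covariance_f_e, add_zero] at h1
  exact h1.trans (by simpa using hk.isHermitian.apply (A i) z)

theorem covariance_obs [DecidableEq ι] (h : IsGPModel P σn k f e) (hk : (Matrix.of k).PosSemidef)
    (A : ι → X) (i j : ι) :
    cov[fun ω => f ω (A i) + e ω i, fun ω => f ω (A j) + e ω j; P] = gram σn k A i j := by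
  have := h.isProbabilityMeasure
  have h1 := covariance_add_left (h.memLp_f (A i)) (h.memLp_e i) (h.memLp_obs A j)
  have h2 := covariance_add_right (h.memLp_e i) (h.memLp_f (A j)) (h.memLp_e j)
  rw [h.covariance_f_obs hk] at h1
  rw [h.covariance_e, covariance_comm (X := fun ω => e ω i) (Y := fun ω => f ω (A j)),
    h.covariance_f_e, zero_add] at h2
  refine h1.trans ?_
  have h3 : k (A j) (A i) = k (A i) (A j) := by simpa using hk.isHermitian.apply (A i) (A j)
  have h4 : cov[fun ω => e ω i, fun ω => f ω (A j) + e ω j; P] = _ := h2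
  rw [h4, h3]
  simp [gram, Matrix.one_apply]

/-- These are the normal equations: the weights `w` solve `gram * w = k_A(z)`, which says that the
residual is orthogonal to each observation. -/
theorem covariance_residual_obs [DecidableEq ι] (h : IsGPModel P σn k f e)
    (hk : (Matrix.of k).PosSemidef) (hσn : 0 < σn) (A : ι → X) (z : X) (j : ι) :
    cov[fun ω => f ω z - postMean σn k A (fun i => f ω (A i) + e ω i) z,
      fun ω => f ω (A j) + e ω j; P] = 0 := by
  have := h.isProbabilityMeasure
  simp_rw [residual_eq hk hσn]
  have hw : ∀ i, MemLp (fun ω => postWeight σn k A z i * (f ω (A i) + e ω i)) 2 P :=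
    fun i => (h.memLp_obs A i).const_mul _
  rw [covariance_fun_sub_left (h.memLp_f z) (memLp_finsetSum _ fun i _ => hw i) (h.memLp_obs A j),
    covariance_fun_sum_left hw (h.memLp_obs A j), h.covariance_f_obs hk]
  simp_rw [covariance_const_mul_left, h.covariance_obs hk]
  have h1 := congrFun (gram_mulVec_postWeight hk hσn A z) j
  have h2 : ∀ i, gram σn k A i j = gram σn k A j i := fun i => by
    conv_lhs => rw [← gram_transpose hk hσn A]
    rfl
  rw [← h1, Matrix.mulVec, dotProduct]
  simp [h2, mul_comm]

theorem memLp_residual [DecidableEq ι] (h : IsGPModel P σn k f e)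
    (hk : (Matrix.of k).PosSemidef) (hσn : 0 < σn) (A : ι → X) (z : X) :
    MemLp (fun ω => f ω z - postMean σn k A (fun i => f ω (A i) + e ω i) z) 2 P := by
  simp_rw [residual_eq hk hσn]
  exact (h.memLp_f z).sub (memLp_finsetSum _ fun i _ => (h.memLp_obs A i).const_mul _)

/-- Residuals and observations are one linear image of the Gaussian vector `(f, e)`. Joint
Gaussianity is what turns the vanishing covariances into independence. -/
theorem hasGaussianLaw_residual_obs [DecidableEq ι] (h : IsGPModel P σn k f e)
    (hk : (Matrix.of k).PosSemidef) (hσn : 0 < σn) (A : ι → X) :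
    HasGaussianLaw (fun ω => (fun z => f ω z - postMean σn k A (fun i => f ω (A i) + e ω i) z,
      fun i => f ω (A i) + e ω i)) P := by
  let F (z : X) : (X → ℝ) × (ι → ℝ) →L[ℝ] ℝ :=
    (ContinuousLinearMap.proj z).comp (ContinuousLinearMap.fst ℝ (X → ℝ) (ι → ℝ))
  let E (i : ι) : (X → ℝ) × (ι → ℝ) →L[ℝ] ℝ :=
    (ContinuousLinearMap.proj i).comp (ContinuousLinearMap.snd ℝ (X → ℝ) (ι → ℝ))
  let Y (i : ι) : (X → ℝ) × (ι → ℝ) →L[ℝ] ℝ := F (A i) + E i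
  let L : (X → ℝ) × (ι → ℝ) →L[ℝ] (X → ℝ) × (ι → ℝ) :=
    (ContinuousLinearMap.pi fun z => F z - ∑ i, postWeight σn k A z i • Y i).prod
      (ContinuousLinearMap.pi Y)
  have h1 : ∀ ω, L (f ω, e ω) = (fun z => f ω z - postMean σn k A (fun i => f ω (A i) + e ω i) z,
      fun i => f ω (A i) + e ω i) := by
    intro ω
    refine Prod.ext (funext fun z => ?_) (funext fun i => ?_)
    · simp only
      rw [residual_eq hk hσn]
      simp [L, F, E, Y, mul_add]
    · simp [L, F, E, Y]
  simp_rw [← h1]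
  exact h.hasGaussianLaw_pair.map_fun L

/-- The residual of the posterior mean is independent of the observations. -/
theorem indepFun_residual_obs [DecidableEq ι] (h : IsGPModel P σn k f e)
    (hk : (Matrix.of k).PosSemidef) (hσn : 0 < σn) (A : ι → X) :
    IndepFun (fun ω z => f ω z - postMean σn k A (fun i => f ω (A i) + e ω i) z)
      (fun ω i => f ω (A i) + e ω i) P :=
  (h.hasGaussianLaw_residual_obs hk hσn A).indepFun_of_covariance_eval
    (X := fun z ω => f ω z - postMean σn k A (fun i => f ω (A i) + e ω i) z)
    (Y := fun i ω => f ω (A i) + e ω i)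
    fun z j => h.covariance_residual_obs hk hσn A z j

theorem integral_residual [DecidableEq ι] (h : IsGPModel P σn k f e)
    (hk : (Matrix.of k).PosSemidef) (hσn : 0 < σn) (A : ι → X) (z : X) :
    ∫ ω, (f ω z - postMean σn k A (fun i => f ω (A i) + e ω i) z) ∂P = 0 := by
  have := h.isProbabilityMeasure
  have hf : ∀ z, Integrable (fun ω => f ω z) P := fun z => (h.memLp_f z).integrable one_le_two
  have he : ∀ i, Integrable (fun ω => e ω i) P := fun i => (h.memLp_e i).integrable one_le_two
  simp_rw [residual_eq hk hσn]
  have hw : ∀ i, Integrable (fun ω => postWeight σn k A z i * (f ω (A i) + e ω i)) P :=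
    fun i => ((hf (A i)).add (he i)).const_mul _
  rw [integral_sub (hf z) (integrable_finsetSum _ fun i _ => hw i),
    integral_finsetSum _ fun i _ => hw i, h.integral_f]
  simp_rw [integral_const_mul]
  have : ∀ i, ∫ ω, (f ω (A i) + e ω i) ∂P = 0 := fun i => by
    rw [integral_add (hf _) (he i), h.integral_f, h.integral_e, add_zero]
  simp [this]

/-- Orthogonality to the observations reduces `cov(r, r)` to `cov(r, f z)`, which is `k z z - w ·
k_A(z)`. -/
theorem variance_residual [DecidableEq ι] (h : IsGPModel P σn k f e)
    (hk : (Matrix.of k).PosSemidef) (hσn : 0 < σn) (A : ι → X) (z : X) :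
    Var[fun ω => f ω z - postMean σn k A (fun i => f ω (A i) + e ω i) z; P] =
      postVar σn k A z := by
  have := h.isProbabilityMeasure
  set r : Ω → ℝ := fun ω => f ω z - postMean σn k A (fun i => f ω (A i) + e ω i) z with hr
  have hrL : MemLp r 2 P := h.memLp_residual hk hσn A z
  have hw : ∀ i, MemLp (fun ω => postWeight σn k A z i * (f ω (A i) + e ω i)) 2 P :=
    fun i => (h.memLp_obs A i).const_mul _
  have hr' : r = fun ω => f ω z - ∑ i, postWeight σn k A z i * (f ω (A i) + e ω i) := by
    funext ω; exact residual_eq hk hσn A _ _ z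
  have hro : ∀ j, cov[r, fun ω => f ω (A j) + e ω j; P] = 0 :=
    fun j => h.covariance_residual_obs hk hσn A z j
  rw [← covariance_self hrL.aemeasurable]
  have h1 : cov[r, r; P] = cov[r, fun ω => f ω z; P] := by
    nth_rewrite 2 [hr']
    rw [covariance_fun_sub_right hrL (h.memLp_f z) (memLp_finsetSum _ fun i _ => hw i),
      covariance_fun_sum_right hw hrL]
    simp_rw [covariance_const_mul_right, hro]
    simp
  rw [h1, hr', covariance_fun_sub_left (h.memLp_f z) (memLp_finsetSum _ fun i _ => hw i)
    (h.memLp_f z), covariance_fun_sum_left hw (h.memLp_f z), h.covariance_f hk]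
  simp_rw [covariance_const_mul_left, fun i => covariance_comm (X := fun ω => f ω (A i) + e ω i)
    (Y := fun ω => f ω z) (μ := P), h.covariance_f_obs hk]
  rw [postVar, dotProduct_comm, ← postWeight]
  rfl

/-- The residual at `z` is centered Gaussian, and its variance is the posterior variance. -/
theorem map_residual [DecidableEq ι] (h : IsGPModel P σn k f e)
    (hk : (Matrix.of k).PosSemidef) (hσn : 0 < σn) (A : ι → X) (z : X) :
    P.map (fun ω => f ω z - postMean σn k A (fun i => f ω (A i) + e ω i) z) =
      gaussianReal 0 (postVar σn k A z).toNNReal := by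
  have h1 := ((h.hasGaussianLaw_residual_obs hk hσn A).fst.map_fun
    (ContinuousLinearMap.proj (R := ℝ) z)).map_eq_gaussianReal
  simp only [ContinuousLinearMap.proj_apply] at h1
  rw [h1, h.integral_residual hk hσn, h.variance_residual hk hσn]

end IsGPModel

end

end BatchTS

namespace BatchTS

noncomputable section

/-! ### Gaussian densities -/

theorem pi_gaussianReal_eq_withDensity {ι : Type*} [Fintype ι] {v : ℝ≥0} (hv : v ≠ 0) :
    Measure.pi (fun _ : ι => gaussianReal 0 v) =
      volume.withDensity fun y => ENNReal.ofReal (∏ i, gaussianPDFReal 0 v (y i)) := by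
  refine Measure.pi_eq fun s hs => ?_
  rw [withDensity_apply _ (MeasurableSet.univ_pi hs), volume_pi, Measure.restrict_pi_pi,
    ← ofReal_integral_eq_lintegral_ofReal, integral_fintype_prod_eq_prod,
    ENNReal.ofReal_prod_of_nonneg]
  · refine Finset.prod_congr rfl fun i _ => ?_
    rw [gaussianReal_apply_eq_integral _ hv]
  · exact fun i _ => integral_nonneg fun x => gaussianPDFReal_nonneg _ _ _
  · exact Integrable.fintype_prod fun i => (integrable_gaussianPDFReal _ _).restrict
  · exact Filter.Eventually.of_forall fun y =>
      Finset.prod_nonneg fun i _ => gaussianPDFReal_nonneg _ _ _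

theorem map_mulVec_withDensity {ι : Type*} [Fintype ι] [DecidableEq ι] {M : Matrix ι ι ℝ}
    (hM : M.det ≠ 0) {p : (ι → ℝ) → ℝ} (hp : Measurable p) :
    (volume.withDensity fun y => ENNReal.ofReal (p y)).map (fun y => M.mulVec y) =
      volume.withDensity fun y => ENNReal.ofReal (|M.det⁻¹| * p (M⁻¹.mulVec y)) := by
  have hMm : Measurable fun y : ι → ℝ => M.mulVec y :=
    (Matrix.toLin' M).continuous_of_finiteDimensional.measurable
  have hMi : Measurable fun y : ι → ℝ => M⁻¹.mulVec y :=
    (Matrix.toLin' M⁻¹).continuous_of_finiteDimensional.measurable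
  have hvol : (volume : Measure (ι → ℝ)).map (fun y => M.mulVec y) =
      ENNReal.ofReal |M.det⁻¹| • volume := Real.map_matrix_volume_pi_eq_smul_volume_pi hM
  have hinv : ∀ y, M⁻¹.mulVec (M.mulVec y) = y := fun y => by
    rw [Matrix.mulVec_mulVec, Matrix.nonsing_inv_mul _ hM.isUnit, Matrix.one_mulVec]
  ext s hs
  rw [Measure.map_apply hMm hs, withDensity_apply _ (hMm hs), withDensity_apply _ hs,
    ← lintegral_indicator (hMm hs)]
  simp_rw [ENNReal.ofReal_mul (abs_nonneg M.det⁻¹)]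
  rw [lintegral_const_mul _ (by fun_prop), ← smul_eq_mul, ← lintegral_smul_measure,
    ← Measure.restrict_smul, ← hvol, ← lintegral_indicator hs, lintegral_map _ hMm]
  · refine lintegral_congr fun y => ?_
    simp only [Set.indicator, hinv]
    rfl
  · exact (by fun_prop : Measurable fun y => ENNReal.ofReal (p (M⁻¹.mulVec y))).indicator hs

theorem log_prod_gaussianPDFReal {ι : Type*} [Fintype ι] {v : ℝ≥0} (hv : v ≠ 0) (y : ι → ℝ) :
    Real.log (∏ i, gaussianPDFReal 0 v (y i)) =
      - (Fintype.card ι / 2 * Real.log (2 * Real.pi * v)) - (∑ i, y i ^ 2) / (2 * v) := by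
  rw [Real.log_prod fun i _ => (gaussianPDFReal_pos 0 v (y i) hv).ne']
  have hv' : (0 : ℝ) < v := by positivity
  have h : ∀ i, Real.log (gaussianPDFReal 0 v (y i)) =
      - (Real.log (2 * Real.pi * v) / 2) - y i ^ 2 / (2 * v) := fun i => by
    rw [gaussianPDFReal, Real.log_mul (by positivity) (by positivity), Real.log_exp, Real.log_inv,
      Real.log_sqrt (by positivity)]
    ring
  simp only [h, Finset.sum_sub_distrib, Finset.sum_const, Finset.card_univ, nsmul_eq_mul,
    Finset.sum_div]
  ring

/-- Gaussian measures on `ι → ℝ` are determined by the means and covariances of the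
coordinates. -/
theorem isGaussian_ext_pi {ι : Type*} [Fintype ι] {μ ν : Measure (ι → ℝ)} [IsGaussian μ]
    [IsGaussian ν] (hm : ∀ i, ∫ v, v i ∂μ = ∫ v, v i ∂ν)
    (hc : ∀ i j, cov[fun v => v i, fun v => v j; μ] = cov[fun v => v i, fun v => v j; ν]) :
    μ = ν := by
  classical
  refine Measure.ext_of_charFunDual (funext fun L => ?_)
  obtain ⟨c, hL⟩ : ∃ c : ι → ℝ, ∀ v, L v = ∑ i, c i * v i := by
    refine ⟨fun i => L (Pi.single i 1), fun v => ?_⟩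
    conv_lhs => rw [← Finset.univ_sum_single v]
    rw [map_sum]
    refine Finset.sum_congr rfl fun i _ => ?_
    have : (Pi.single i (v i) : ι → ℝ) = v i • Pi.single i 1 := by
      rw [← Pi.single_smul]; simp
    rw [this, map_smul, smul_eq_mul, mul_comm]
  have hlp : ∀ (ρ : Measure (ι → ℝ)) [IsGaussian ρ] (i : ι), MemLp (fun v : ι → ℝ => v i) 2 ρ :=
    fun ρ _ i => (IsGaussian.memLp_dual ρ (ContinuousLinearMap.proj (R := ℝ) i) 2 (by simp))
  have hint : ∀ (ρ : Measure (ι → ℝ)) [IsGaussian ρ],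
      ∫ v, L v ∂ρ = ∑ i, c i * ∫ v, v i ∂ρ := fun ρ _ => by
    simp_rw [hL]
    rw [integral_finsetSum _ fun i _ => ((hlp ρ i).integrable one_le_two).const_mul _]
    simp_rw [integral_const_mul]
  have hvar : ∀ (ρ : Measure (ι → ℝ)) [IsGaussian ρ], Var[L; ρ] = ∑ i, ∑ j,
      c i * (c j * cov[fun v => v i, fun v => v j; ρ]) := fun ρ _ => by
    have hL' : (L : (ι → ℝ) → ℝ) = fun v => ∑ i, c i * v i := funext hL
    have hlp' : ∀ i, MemLp (fun v : ι → ℝ => c i * v i) 2 ρ :=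
      fun i => (hlp ρ i).const_mul _
    rw [← covariance_self L.continuous.aemeasurable, hL',
      covariance_fun_sum_fun_sum hlp' hlp']
    simp_rw [covariance_const_mul_left, covariance_const_mul_right]
  have h1 : ∀ (ρ : Measure (ι → ℝ)), (∫ v, (L v : ℂ) ∂ρ) = ((∫ v, L v ∂ρ : ℝ) : ℂ) :=
    fun ρ => integral_complex_ofReal
  rw [IsGaussian.charFunDual_eq, IsGaussian.charFunDual_eq, h1, h1, hint μ, hint ν, hvar μ, hvar ν]
  simp_rw [hm, hc]

open scoped MatrixOrder in
theorem gpLaw_eq_map_pi {ι : Type*} [Fintype ι] [DecidableEq ι] (S : Matrix ι ι ℝ) :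
    gpLaw (fun i j => S i j) = (Measure.pi fun _ : ι => gaussianReal 0 1).map
      (fun y => (CFC.sqrt S).mulVec y) := by
  have hM : Measurable fun y : ι → ℝ => (CFC.sqrt S).mulVec y :=
    (Matrix.toLin' (CFC.sqrt S)).continuous_of_finiteDimensional.measurable
  rw [gpLaw, multivariateGaussian, ← map_pi_eq_stdGaussian, Measure.map_map (by fun_prop)
    (by fun_prop), Measure.map_map (by fun_prop) (by fun_prop)]
  congr 1
  funext y i
  simp
  rfl

open scoped MatrixOrder in
/-- A nondegenerate centered Gaussian law has the usual density. -/
theorem gpLaw_eq_withDensity {ι : Type*} [Fintype ι] [DecidableEq ι] {S : Matrix ι ι ℝ}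
    (hS : S.PosDef) :
    ∃ q : (ι → ℝ) → ℝ, Measurable q ∧ (∀ y, 0 < q y) ∧
      gpLaw (fun i j => S i j) = volume.withDensity (fun y => ENNReal.ofReal (q y)) ∧
      ∀ y, Real.log (q y) = - (Real.log S.det / 2) -
        Fintype.card ι / 2 * Real.log (2 * Real.pi) - (y ⬝ᵥ S⁻¹.mulVec y) / 2 := by
  -- The law is the image of the standard Gaussian under `M = √S`; `det M ^ 2 = det S` gives the
  -- normalization and `M⁻¹ M⁻¹ = S⁻¹` the quadratic form.
  set M := CFC.sqrt S with hMdef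
  have hMM : M * M = S := CFC.sqrt_mul_sqrt_self S hS.posSemidef.nonneg
  have hMpsd : M.PosSemidef := Matrix.nonneg_iff_posSemidef.1 (CFC.sqrt_nonneg S)
  have hdet : M.det * M.det = S.det := by rw [← Matrix.det_mul, hMM]
  have hMdet : M.det ≠ 0 := fun h => hS.det_pos.ne' (by rw [← hdet, h, zero_mul])
  have hMi : Measurable fun y : ι → ℝ => M⁻¹.mulVec y :=
    (Matrix.toLin' M⁻¹).continuous_of_finiteDimensional.measurable
  have hpm : Measurable fun y : ι → ℝ => ∏ i, gaussianPDFReal 0 1 (y i) :=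
    Finset.measurable_prod _ fun i _ =>
      (measurable_gaussianPDFReal 0 1).comp (measurable_pi_apply i)
  refine ⟨fun y => |M.det⁻¹| * ∏ i, gaussianPDFReal 0 1 (M⁻¹.mulVec y i),
    (hpm.comp hMi).const_mul _, fun y => ?_, ?_, fun y => ?_⟩
  · have : 0 < |M.det⁻¹| := abs_pos.2 (inv_ne_zero hMdet)
    exact mul_pos this (Finset.prod_pos fun i _ => gaussianPDFReal_pos _ _ _ one_ne_zero)
  · rw [gpLaw_eq_map_pi, pi_gaussianReal_eq_withDensity one_ne_zero,
      map_mulVec_withDensity hMdet hpm]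
  · rw [Real.log_mul (abs_ne_zero.2 (inv_ne_zero hMdet))
      (Finset.prod_pos fun i _ => gaussianPDFReal_pos _ _ _ one_ne_zero).ne',
      log_prod_gaussianPDFReal one_ne_zero, Real.log_abs, Real.log_inv, ← hdet,
      Real.log_mul hMdet hMdet]
    have hq : ∑ i, (M⁻¹.mulVec y i) ^ 2 = y ⬝ᵥ S⁻¹.mulVec y := by
      have hT : (M⁻¹).transpose = M⁻¹ := by
        rw [Matrix.transpose_nonsing_inv]
        congr 1
        simpa using hMpsd.isHermitian.eq
      rw [← hMM, Matrix.mul_inv_rev, ← Matrix.mulVec_mulVec, Matrix.dotProduct_mulVec,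
        ← Matrix.mulVec_transpose, hT]
      simp [dotProduct, pow_two]
    rw [hq]
    simp
    ring

/-! ### Mutual information of an additive channel -/

/-- The mutual information between the input and the output of an additive noise channel, in terms
of the densities of the noise and of the output. -/
theorem toReal_klDiv_additive {ι : Type*} [Fintype ι] {μ ν : Measure (ι → ℝ)}
    [IsProbabilityMeasure μ] [IsProbabilityMeasure ν] {φ q : (ι → ℝ) → ℝ}
    (hφ : Measurable φ) (hq : Measurable q) (hφ0 : ∀ y, 0 < φ y) (hq0 : ∀ y, 0 < q y)
    (hν : ν = volume.withDensity fun y => ENNReal.ofReal (φ y))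
    (hout : (μ.prod ν).map (fun p => p.1 + p.2) =
      volume.withDensity fun y => ENNReal.ofReal (q y)) :
    (InformationTheory.klDiv ((μ.prod ν).map fun p => (p.1 + p.2, p.1))
      (((μ.prod ν).map fun p => p.1 + p.2).prod μ)).toReal =
      ∫ p, (Real.log (φ p.2) - Real.log (q (p.1 + p.2))) ∂(μ.prod ν) := by
  set J := (μ.prod ν).map fun p => (p.1 + p.2, p.1) with hJ
  set L := (μ.prod ν).map fun p => p.1 + p.2 with hL
  have hLp : IsProbabilityMeasure L := Measure.isProbabilityMeasure_map (by fun_prop)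
  have hJp : IsProbabilityMeasure J := Measure.isProbabilityMeasure_map (by fun_prop)
  set d : (ι → ℝ) × (ι → ℝ) → ℝ≥0∞ := fun p =>
    ENNReal.ofReal (φ (p.1 - p.2) / q p.1) with hd
  have hdm : Measurable d := by fun_prop
  -- The reference measure is `volume.prod μ`, not Lebesgue measure in both variables: the input law
  -- `μ` may be singular, for instance when points are repeated.
  have hJ1 : J = (volume.prod μ).withDensity fun p => ENNReal.ofReal (φ (p.1 - p.2)) := by
    refine Measure.ext_of_lintegral _ fun F hF => ?_
    rw [hJ, lintegral_map hF (by fun_prop), lintegral_prod _ (by fun_prop),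
      lintegral_withDensity_eq_lintegral_mul _ (by fun_prop) hF,
      lintegral_prod_symm' _ (by fun_prop)]
    refine lintegral_congr fun z => ?_
    rw [hν, lintegral_withDensity_eq_lintegral_mul _ (by fun_prop) (by fun_prop)]
    refine Eq.trans (lintegral_congr fun y => ?_) (lintegral_add_right_eq_self _ z)
    simp [add_comm y z]
  have hL1 : L.prod μ = (volume.prod μ).withDensity fun p => ENNReal.ofReal (q p.1) := by
    rw [hout, prod_withDensity_left (by fun_prop)]
  have hJL : J = (L.prod μ).withDensity d := by
    rw [hJ1, hL1, ← withDensity_mul _ (by fun_prop) hdm]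
    congr 1
    funext p
    rw [Pi.mul_apply, hd, ← ENNReal.ofReal_mul (hq0 _).le, mul_div_cancel₀ _ (hq0 _).ne']
  have hac : J ≪ L.prod μ := by rw [hJL]; exact withDensity_absolutelyContinuous _ _
  rw [InformationTheory.toReal_klDiv_of_measure_eq hac (by simp)]
  have hrn : J.rnDeriv (L.prod μ) =ᵐ[L.prod μ] d := by
    rw [hJL]; exact Measure.rnDeriv_withDensity _ hdm
  have hllr : llr J (L.prod μ) =ᵐ[J] fun p => Real.log (φ (p.1 - p.2)) - Real.log (q p.1) := by
    filter_upwards [hac.ae_eq hrn] with p hp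
    rw [llr, hp, hd, ENNReal.toReal_ofReal (div_nonneg (hφ0 _).le (hq0 _).le),
      Real.log_div (hφ0 _).ne' (hq0 _).ne']
  rw [integral_congr_ae hllr, hJ, integral_map (by fun_prop)]
  · simp
  · have : Measurable fun p : (ι → ℝ) × (ι → ℝ) => Real.log (φ (p.1 - p.2)) - Real.log (q p.1) := by
      fun_prop
    exact this.aestronglyMeasurable

end

end BatchTS

/-! ### Closed form of the information gain. -/

namespace BatchTS

noncomputable section

variable {X : Type*} [Fintype X] [DecidableEq X] {k : X → X → ℝ} {σn : ℝ}

/-- The product space in the definition of `infoGain` is an instance of the model, so the moment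
formulas apply there. -/
theorem isGPModel_prod {ι : Type*} [Fintype ι] :
    IsGPModel ((gpLaw k).prod (Measure.pi fun _ : ι => noiseLaw σn)) σn k Prod.fst Prod.snd where
  measurable_f := measurable_fst
  measurable_e := measurable_snd
  law_f := measurePreserving_fst.map_eq
  law_e i := by
    have h := (measurePreserving_eval (fun _ : ι => noiseLaw σn) i).comp
      (measurePreserving_snd (μ := gpLaw k) (ν := Measure.pi fun _ : ι => noiseLaw σn))
    exact h.map_eq
  indep_e := by
    have hs := measurePreserving_snd (μ := gpLaw k) (ν := Measure.pi fun _ : ι => noiseLaw σn)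
    have hi : ∀ i, ((gpLaw k).prod (Measure.pi fun _ : ι => noiseLaw σn)).map
        (fun p => p.2 i) = noiseLaw σn := fun i =>
      ((measurePreserving_eval (fun _ : ι => noiseLaw σn) i).comp hs).map_eq
    rw [iIndepFun_iff_map_fun_eq_pi_map fun i => by fun_prop]
    simp_rw [hi]
    exact hs.map_eq
  indep := indepFun_prod measurable_id measurable_id

namespace IsGPModel

variable {Ω ι : Type*} [MeasurableSpace Ω] [Fintype ι] [DecidableEq ι]
  {P : Measure Ω} {f : Ω → X → ℝ} {e : Ω → ι → ℝ}

theorem integral_obs {ι : Type*} [Fintype ι] {e : Ω → ι → ℝ} (h : IsGPModel P σn k f e) (A : ι → X)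
    (i : ι) :
    ∫ ω, (f ω (A i) + e ω i) ∂P = 0 := by
  have := h.isProbabilityMeasure
  rw [integral_add ((h.memLp_f (A i)).integrable one_le_two)
    ((h.memLp_e i).integrable one_le_two), h.integral_f, h.integral_e, add_zero]

theorem integral_obs_mul_obs (h : IsGPModel P σn k f e) (hk : (Matrix.of k).PosSemidef)
    (A : ι → X) (i j : ι) :
    ∫ ω, (f ω (A i) + e ω i) * (f ω (A j) + e ω j) ∂P = gram σn k A i j := by
  have := h.isProbabilityMeasure
  have h1 := covariance_eq_sub (h.memLp_obs A i) (h.memLp_obs A j)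
  rw [h.covariance_obs hk, h.integral_obs, zero_mul, sub_zero] at h1
  exact h1.symm

theorem integral_e_sq (h : IsGPModel P σn k f e) (i : ι) : ∫ ω, e ω i ^ 2 ∂P = σn ^ 2 := by
  have := h.isProbabilityMeasure
  have h1 := covariance_eq_sub (h.memLp_e i) (h.memLp_e i)
  rw [h.covariance_e, if_pos rfl, h.integral_e, zero_mul, sub_zero] at h1
  rw [h1]
  simp [pow_two]

/-- The observations have the centered Gaussian law whose covariance is the Gram matrix. -/
theorem map_obs (h : IsGPModel P σn k f e) (hk : (Matrix.of k).PosSemidef) (hσn : 0 < σn)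
    (A : ι → X) :
    P.map (fun ω i => f ω (A i) + e ω i) = gpLaw (fun i j => gram σn k A i j) := by
  have hY := (h.hasGaussianLaw_residual_obs hk hσn A).snd
  have hm := hY.aemeasurable
  have := hY.isGaussian_map
  have hG : (Matrix.of fun i j => gram σn k A i j).PosSemidef := (gram_posDef hk hσn A).posSemidef
  refine isGaussian_ext_pi (fun i => ?_) fun i j => ?_
  · rw [integral_gpLaw, integral_map (f := fun v : ι → ℝ => v i) hm
      (measurable_pi_apply i).aestronglyMeasurable, h.integral_obs]
  · rw [covariance_gpLaw hG, covariance_map_fun (measurable_pi_apply i).aestronglyMeasurable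
      (measurable_pi_apply j).aestronglyMeasurable hm, h.covariance_obs hk]

/-- The expectation is the trace of `G⁻¹ G`, because `G` is the second-moment matrix of the
observations. -/
theorem integral_quadraticForm_obs (h : IsGPModel P σn k f e) (hk : (Matrix.of k).PosSemidef)
    (hσn : 0 < σn) (A : ι → X) :
    Integrable (fun ω => (fun i => f ω (A i) + e ω i) ⬝ᵥ
      (gram σn k A)⁻¹.mulVec fun i => f ω (A i) + e ω i) P ∧
    ∫ ω, (fun i => f ω (A i) + e ω i) ⬝ᵥ
      (gram σn k A)⁻¹.mulVec (fun i => f ω (A i) + e ω i) ∂P = Fintype.card ι := by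
  set G := gram σn k A
  have hint : ∀ i j, Integrable
      (fun ω => (f ω (A i) + e ω i) * (G⁻¹ i j * (f ω (A j) + e ω j))) P := fun i j =>
    (h.memLp_obs A i).integrable_mul ((h.memLp_obs A j).const_mul _)
  simp only [dotProduct, Matrix.mulVec, Finset.mul_sum]
  refine ⟨integrable_finsetSum _ fun i _ => integrable_finsetSum _ fun j _ => hint i j, ?_⟩
  rw [integral_finsetSum _ fun i _ => integrable_finsetSum _ fun j _ => hint i j]
  have h1 : ∀ i, ∫ ω, ∑ j, (f ω (A i) + e ω i) * (G⁻¹ i j * (f ω (A j) + e ω j)) ∂P = 1 := by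
    intro i
    rw [integral_finsetSum _ fun j _ => hint i j]
    have h2 : ∀ j, ∫ ω, (f ω (A i) + e ω i) * (G⁻¹ i j * (f ω (A j) + e ω j)) ∂P =
        G⁻¹ i j * G j i := fun j => by
      rw [show G j i = gram σn k A j i from rfl, ← h.integral_obs_mul_obs hk,
        ← integral_const_mul]
      congr 1
      funext ω
      ring
    simp_rw [h2]
    rw [← Matrix.mul_apply, Matrix.nonsing_inv_mul _ (gram_isUnit_det hk hσn A),
      Matrix.one_apply_eq]
  simp [h1]

end IsGPModel

/-- The information gain in closed form. -/
theorem infoGain_eq (hk : (Matrix.of k).PosSemidef) (hσn : 0 < σn) {n : ℕ} (A : Fin n → X) :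
    infoGain σn k A = Real.log (gram σn k A).det / 2 - n * Real.log σn := by
  set ν : Measure (Fin n → ℝ) := Measure.pi fun _ => noiseLaw σn with hν
  set Q := (gpLaw k).prod ν with hQ
  have hmod : IsGPModel Q σn k Prod.fst Prod.snd := isGPModel_prod
  set res : (X → ℝ) → Fin n → ℝ := fun v j => v (A j) with hres
  have hresm : Measurable res := measurable_pi_iff.2 fun j => measurable_pi_apply _
  set μ := (gpLaw k).map res with hμ
  have hμp : IsProbabilityMeasure μ := Measure.isProbabilityMeasure_map hresm.aemeasurable
  have hμν : μ.prod ν = Q.map (Prod.map res id) := by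
    rw [hμ, hQ, ← Measure.map_prod_map _ _ hresm measurable_id, Measure.map_id]
  have hv : (σn ^ 2).toNNReal ≠ 0 := by
    rw [Ne, Real.toNNReal_eq_zero, not_le]; positivity
  have hpm : Measurable (Prod.map res (id : (Fin n → ℝ) → Fin n → ℝ)) :=
    hresm.prodMap measurable_id
  obtain ⟨q, hqm, hq0, hqd, hqlog⟩ := gpLaw_eq_withDensity (gram_posDef hk hσn A)
  have hφm : Measurable fun y : Fin n → ℝ => ∏ i, gaussianPDFReal 0 (σn ^ 2).toNNReal (y i) :=
    Finset.measurable_prod _ fun i _ =>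
      (measurable_gaussianPDFReal 0 _).comp (measurable_pi_apply i)
  have hsum : (μ.prod ν).map (fun p => p.1 + p.2) =
      Q.map fun p => fun j => p.1 (A j) + p.2 j := by
    rw [hμν, Measure.map_map (by fun_prop) hpm]; rfl
  have hpair : (μ.prod ν).map (fun p => (p.1 + p.2, p.1)) =
      Q.map fun p => (fun j => p.1 (A j) + p.2 j, fun j => p.1 (A j)) := by
    rw [hμν, Measure.map_map (by fun_prop) hpm]; rfl
  have hfst : Q.map (fun p => fun j => p.1 (A j)) = μ := by
    rw [hμ, ← (measurePreserving_fst (μ := gpLaw k) (ν := ν)).map_eq,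
      Measure.map_map hresm measurable_fst]
    rfl
  have key := toReal_klDiv_additive (μ := μ) (ν := ν) hφm hqm
    (fun y => Finset.prod_pos fun i _ => gaussianPDFReal_pos _ _ _ hv) hq0
    (by rw [hν]; exact pi_gaussianReal_eq_withDensity hv)
    (by rw [hsum, hmod.map_obs hk hσn A, hqd])
  rw [infoGain, mutualInfo, ← hpair, ← hsum, hfst, key, hμν, integral_map hpm.aemeasurable]
  swap
  · have : Measurable fun p : (Fin n → ℝ) × (Fin n → ℝ) =>
        Real.log (∏ i, gaussianPDFReal 0 (σn ^ 2).toNNReal (p.2 i)) -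
          Real.log (q (p.1 + p.2)) :=
      (Real.measurable_log.comp (hφm.comp measurable_snd)).sub
        (Real.measurable_log.comp (hqm.comp (measurable_fst.add measurable_snd)))
    exact this.aestronglyMeasurable
  have hvc : (((σn ^ 2).toNNReal : ℝ≥0) : ℝ) = σn ^ 2 := Real.coe_toNNReal _ (sq_nonneg _)
  obtain ⟨hi, hie⟩ := hmod.integral_quadraticForm_obs hk hσn A
  have he : Integrable (fun p : (X → ℝ) × (Fin n → ℝ) => ∑ i, p.2 i ^ 2) Q :=
    integrable_finsetSum _ fun i _ => (hmod.memLp_e i).integrable_sq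
  have hee : ∫ p : (X → ℝ) × (Fin n → ℝ), ∑ i, p.2 i ^ 2 ∂Q = n * σn ^ 2 := by
    rw [integral_finsetSum _ fun i _ => (hmod.memLp_e i).integrable_sq]
    simp [hmod.integral_e_sq]
  -- The log-likelihood ratio is a constant plus two quadratic forms with expectations `-n/2` and
  -- `n/2`. They cancel, and the constant is the information gain.
  have hfun : ∀ p : (X → ℝ) × (Fin n → ℝ),
      Real.log (∏ i, gaussianPDFReal 0 (σn ^ 2).toNNReal ((Prod.map res id p).2 i)) -
        Real.log (q ((Prod.map res id p).1 + (Prod.map res id p).2)) =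
      (Real.log (gram σn k A).det / 2 - n * Real.log σn) +
        ((∑ i, p.2 i ^ 2) * (-(1 / (2 * σn ^ 2))) +
        ((fun i => p.1 (A i) + p.2 i) ⬝ᵥ
          (gram σn k A)⁻¹.mulVec (fun i => p.1 (A i) + p.2 i)) * (1 / 2)) := by
    intro p
    rw [log_prod_gaussianPDFReal hv, hqlog, hvc, Real.log_mul (by positivity) (by positivity),
      Real.log_pow]
    have : (Prod.map res id p).1 + (Prod.map res id p).2 = fun i => p.1 (A i) + p.2 i := rfl
    rw [this]
    simp only [Fintype.card_fin, Prod.map_snd, id]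
    push_cast
    ring
  simp_rw [hfun]
  have hsum2 : Integrable (fun p : (X → ℝ) × (Fin n → ℝ) =>
      (∑ i, p.2 i ^ 2) * (-(1 / (2 * σn ^ 2))) + ((fun i => p.1 (A i) + p.2 i) ⬝ᵥ
          (gram σn k A)⁻¹.mulVec (fun i => p.1 (A i) + p.2 i)) * (1 / 2)) Q :=
    (he.mul_const _).add (hi.mul_const _)
  rw [integral_add (integrable_const _) hsum2, integral_add (he.mul_const _) (hi.mul_const _),
    integral_mul_const, integral_mul_const, hee,
    hie]
  have : σn ^ 2 ≠ 0 := by positivity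
  simp
  field_simp
  ring

end

end BatchTS

namespace BatchTS

noncomputable section

/-! ### Events on which a variable is informative only through the observations -/

section Abstract

variable {Ω 𝓩 𝓨 𝒲 : Type*} [MeasurableSpace Ω] [MeasurableSpace 𝓩] [MeasurableSpace 𝓨]
  [MeasurableSpace 𝒲]

/-- On the event `E`, the conditional (sub-probability) law of `W` given `Z` depends on `Z` only
through `obs Z`. -/
def DependsOnlyOn (P : Measure Ω) (Z : Ω → 𝓩) (obs : 𝓩 → 𝓨) (W : Ω → 𝒲) (E : Set Ω) : Prop :=
  ∃ κ : Kernel 𝓨 𝒲, IsSFiniteKernel κ ∧ ∀ F : 𝓩 × 𝒲 → ℝ≥0∞, Measurable F →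
    ∫⁻ ω in E, F (Z ω, W ω) ∂P = ∫⁻ ω, ∫⁻ w, F (Z ω, w) ∂κ (obs (Z ω)) ∂P

variable {P : Measure Ω} {Z : Ω → 𝓩} {obs : 𝓩 → 𝓨} {W : Ω → 𝒲} {E : Set Ω}

/-- A constant kernel works: `W` carries no information on `Z` at all. -/
theorem DependsOnlyOn.of_indepFun [IsProbabilityMeasure P] (hZ : Measurable Z) (hW : Measurable W)
    (h : IndepFun Z W P) (obs : 𝓩 → 𝓨) : DependsOnlyOn P Z obs W Set.univ := by
  have : IsProbabilityMeasure (P.map W) := Measure.isProbabilityMeasure_map hW.aemeasurable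
  refine ⟨Kernel.const _ (P.map W), inferInstance, fun F hF => ?_⟩
  rw [Measure.restrict_univ, ← lintegral_map (f := F) (g := fun ω => (Z ω, W ω)) hF (hZ.prodMk hW),
    (indepFun_iff_map_prod_eq_prod_map_map hZ.aemeasurable hW.aemeasurable).1 h,
    lintegral_prod _ hF.aemeasurable, lintegral_map hF.lintegral_prod_right' hZ]
  rfl

/-- Restricting to an event decided by the observations and `W` multiplies the kernel by an
indicator. The kernel loses mass, which is why it is not required to be Markov. -/
theorem DependsOnlyOn.inter (h : DependsOnlyOn P Z obs W E) (hZ : Measurable Z)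
    (hobs : Measurable obs) (hW : Measurable W) {T : Set (𝓨 × 𝒲)} (hT : MeasurableSet T) :
    DependsOnlyOn P Z obs W (E ∩ {ω | (obs (Z ω), W ω) ∈ T}) := by
  obtain ⟨κ, hκ, h⟩ := h
  have hTm : MeasurableSet {ω | (obs (Z ω), W ω) ∈ T} := ((hobs.comp hZ).prodMk hW) hT
  let d : 𝓨 → 𝒲 → ℝ≥0∞ := fun y w => T.indicator 1 (y, w)
  have hd : Measurable (Function.uncurry d) := measurable_one.indicator hT
  refine ⟨Kernel.withDensity κ d, Kernel.IsSFiniteKernel.withDensity κ fun y w => ?_,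
    fun F hF => ?_⟩
  · by_cases hyw : (y, w) ∈ T <;> simp [d, hyw]
  · have hF' : Measurable fun p : 𝓩 × 𝒲 => d (obs p.1) p.2 * F p :=
      (hd.comp ((hobs.comp measurable_fst).prodMk measurable_snd)).mul hF
    have h1 := h _ hF'
    simp only at h1
    have h2 : ∀ ω, ∫⁻ w, F (Z ω, w) ∂(Kernel.withDensity κ d (obs (Z ω))) =
        ∫⁻ w, d (obs (Z ω)) w * F (Z ω, w) ∂κ (obs (Z ω)) := fun ω =>
      Kernel.lintegral_withDensity κ hd _ (hF.comp measurable_prodMk_left)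
    simp_rw [h2]
    rw [← h1, Set.inter_comm, ← Measure.restrict_restrict hTm, ← lintegral_indicator hTm]
    refine lintegral_congr fun ω => ?_
    by_cases hω : (obs (Z ω), W ω) ∈ T <;> simp [d, hω]

/-- Passing to finer observations is harmless; this lets the observations grow from round to round.
-/
theorem DependsOnlyOn.of_comp {𝓨' : Type*} [MeasurableSpace 𝓨'] {obs' : 𝓩 → 𝓨'} {c : 𝓨' → 𝓨}
    (h : DependsOnlyOn P Z obs W E) (hc : Measurable c) (hobs : ∀ z, obs z = c (obs' z)) :
    DependsOnlyOn P Z obs' W E := by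
  obtain ⟨κ, hκ, h⟩ := h
  refine ⟨κ.comap c hc, inferInstance, fun F hF => ?_⟩
  simp_rw [h F hF, hobs, Kernel.comap_apply]

/-- Adding to `W` a variable `G` whose conditional law given `(Z, W)` is a function of the
observations. -/
theorem DependsOnlyOn.extend {𝒢 𝒲' : Type*} [MeasurableSpace 𝒢] [MeasurableSpace 𝒲']
    (h : DependsOnlyOn P Z obs W E) (hobs : Measurable obs) {G : Ω → 𝒢} (η : Kernel 𝓨 𝒢)
    [IsSFiniteKernel η]
    (hG : ∀ Φ : (𝓩 × 𝒲) × 𝒢 → ℝ≥0∞, Measurable Φ →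
      ∫⁻ ω in E, Φ ((Z ω, W ω), G ω) ∂P = ∫⁻ ω in E, ∫⁻ w, Φ ((Z ω, W ω), w) ∂η (obs (Z ω)) ∂P)
    {c : 𝒲 × 𝒢 → 𝒲'} (hc : Measurable c) {W' : Ω → 𝒲'} (hW' : ∀ ω, W' ω = c (W ω, G ω)) :
    DependsOnlyOn P Z obs W' E := by
  obtain ⟨κ, hκ, h⟩ := h
  refine ⟨(κ ⊗ₖ (η.comap Prod.fst measurable_fst)).map c, inferInstance, fun F hF => ?_⟩
  have hΦ : Measurable fun p : (𝓩 × 𝒲) × 𝒢 => F (p.1.1, c (p.1.2, p.2)) :=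
    hF.comp ((measurable_fst.comp measurable_fst).prodMk
      (hc.comp ((measurable_snd.comp measurable_fst).prodMk measurable_snd)))
  simp_rw [hW']
  have h1 := hG _ hΦ
  simp only at h1
  rw [h1]
  have hF' : Measurable fun p : 𝓩 × 𝒲 => ∫⁻ w, F (p.1, c (p.2, w)) ∂η (obs p.1) := by
    exact Measurable.lintegral_kernel_prod_right'
      (κ := η.comap (fun p : 𝓩 × 𝒲 => obs p.1) (hobs.comp measurable_fst)) hΦ
  have h2 := h _ hF'
  simp only at h2
  rw [h2]
  refine lintegral_congr fun ω => ?_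
  have hFc : Measurable fun p : 𝒲 × 𝒢 => F (Z ω, c p) := hF.comp (measurable_const.prodMk hc)
  have hFm : Measurable fun w => F (Z ω, w) := hF.comp measurable_prodMk_left
  rw [Kernel.lintegral_map _ hc _ hFm,
    Kernel.lintegral_compProd _ _ _ hFc]
  rfl

/-- A function of `Z` that is independent of the observations is independent of every event that
is determined, on `E`, by the observations and `W`. -/
theorem DependsOnlyOn.restrict_map {R : Type*} [MeasurableSpace R] {r : 𝓩 → R}
    (h : DependsOnlyOn P Z obs W E) (hZ : Measurable Z) (hobs : Measurable obs)
    (hr : Measurable r) (hind : IndepFun (fun ω => r (Z ω)) (fun ω => obs (Z ω)) P)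
    [IsProbabilityMeasure P] :
    (P.restrict E).map (fun ω => r (Z ω)) = P E • P.map (fun ω => r (Z ω)) := by
  obtain ⟨κ, hκ, h⟩ := h
  have hrZ : Measurable fun ω => r (Z ω) := hr.comp hZ
  ext S hS
  rw [Measure.map_apply hrZ hS, Measure.smul_apply, Measure.map_apply hrZ hS, smul_eq_mul]
  have hB : Measurable fun y => κ y Set.univ := κ.measurable_coe MeasurableSet.univ
  have hE : P E = ∫⁻ ω, κ (obs (Z ω)) Set.univ ∂P := by
    have := h (fun _ => 1) measurable_const
    simpa using this
  have hS1 : Measurable (S.indicator (1 : R → ℝ≥0∞)) := measurable_one.indicator hS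
  have h1 := h (fun p => S.indicator 1 (r p.1)) (hS1.comp (hr.comp measurable_fst))
  simp only [lintegral_const] at h1
  -- The mass of the kernel is the conditional probability of `E` given `Z`. It is a function of the
  -- observations alone, hence independent of `r Z`, and the integral factors.
  have h2 := lintegral_mul_eq_lintegral_mul_lintegral_of_indepFun (hS1.comp hrZ)
    (hB.comp (hobs.comp hZ)) (hind.comp hS1 hB)
  have h3 : ∀ ν : Measure Ω, ∫⁻ ω, S.indicator 1 (r (Z ω)) ∂ν = ν ((fun ω => r (Z ω)) ⁻¹' S) := by
    intro ν
    rw [← lintegral_indicator_one (hrZ hS)]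
    rfl
  rw [← h3, h1, hE, mul_comm, ← h3]
  exact h2

end Abstract

/-- The kernel of i.i.d. draws from a Markov kernel. -/
def iidKernel {α β : Type*} [MeasurableSpace α] [MeasurableSpace β] (ι : Type*) [Fintype ι]
    (κ : Kernel α β) [IsMarkovKernel κ] : Kernel α (ι → β) where
  toFun a := Measure.pi fun _ => κ a
  measurable' := by
    refine Measurable.measure_of_isPiSystem_of_isProbabilityMeasure generateFrom_pi.symm
      isPiSystem_pi ?_
    rintro _ ⟨s, hs, rfl⟩
    simp_rw [Measure.pi_pi]
    exact Finset.measurable_prod _ fun i _ => κ.measurable_coe (hs i (Set.mem_univ i))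

instance {α β : Type*} [MeasurableSpace α] [MeasurableSpace β] (ι : Type*) [Fintype ι]
    (κ : Kernel α β) [IsMarkovKernel κ] : IsMarkovKernel (iidKernel ι κ) :=
  ⟨fun a => inferInstanceAs (IsProbabilityMeasure (Measure.pi fun _ => κ a))⟩

theorem lintegral_iidKernel_eval {α β ι : Type*} [MeasurableSpace α] [MeasurableSpace β]
    [Fintype ι] (κ : Kernel α β) [IsMarkovKernel κ] (a : α) (i : ι) {F : β → ℝ≥0∞}
    (hF : Measurable F) : ∫⁻ w, F (w i) ∂iidKernel ι κ a = ∫⁻ v, F v ∂κ a :=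
  (measurePreserving_eval (fun _ : ι => κ a) i).lintegral_comp hF

end

end BatchTS

namespace BatchTS

noncomputable section

/-! ### Conditional laws along a run -/

/-- The values observed at the fixed points `A` when the unknown function and the noise are
`z = (f, ε)`. -/
def obsAt {X : Type*} {m t : ℕ} (A : Fin t × Fin m → X) (z : (X → ℝ) × (ℕ → Fin m → ℝ)) :
    Fin t × Fin m → ℝ :=
  fun p => z.1 (A p) + z.2 p.1 p.2

theorem measurable_obsAt {X : Type*} [Fintype X] [MeasurableSpace X] [DiscreteMeasurableSpace X]
    {m t : ℕ} :
    Measurable fun p : (Fin t × Fin m → X) × ((X → ℝ) × (ℕ → Fin m → ℝ)) => obsAt p.1 p.2 := by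
  have hev : Measurable fun p : (X → ℝ) × X => p.1 p.2 :=
    measurable_from_prod_countable_left fun a => measurable_pi_apply a
  refine measurable_pi_iff.2 fun q => Measurable.add ?_ ?_
  · exact hev.comp ((measurable_fst.comp measurable_snd).prodMk
      ((measurable_pi_apply q).comp measurable_fst))
  · exact (measurable_pi_apply q.2).comp ((measurable_pi_apply (q.1 : ℕ)).comp
      (measurable_snd.comp measurable_snd))

theorem measurable_obsAt_right {X : Type*} {m t : ℕ} (A : Fin t × Fin m → X) :
    Measurable (obsAt A) :=
  measurable_pi_iff.2 fun q => ((measurable_pi_apply (A q)).comp measurable_fst).add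
    ((measurable_pi_apply q.2).comp ((measurable_pi_apply (q.1 : ℕ)).comp measurable_snd))

theorem measurable_fin_snoc {α : Type*} [MeasurableSpace α] {t : ℕ} :
    Measurable fun p : (Fin t → α) × α => (Fin.snoc p.1 p.2 : Fin (t + 1) → α) := by
  refine measurable_pi_iff.2 fun s => ?_
  cases s using Fin.lastCases with
  | last => simpa using measurable_snd
  | cast s =>
    simp only [Fin.snoc_castSucc]
    exact (measurable_pi_apply s).comp measurable_fst

namespace IsRun

variable {Ω X 𝒰 : Type*} [MeasurableSpace Ω] [Fintype X] [DecidableEq X] [MeasurableSpace X]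
  [MeasurableSpace 𝒰] {P : Measure Ω} [IsProbabilityMeasure P]
  {σn : ℝ} {k : X → X → ℝ} {m : ℕ} {f : Ω → X → ℝ} {ε : Ω → ℕ → Fin m → ℝ} {U : Ω → 𝒰}
  {g : ℕ → Ω → Fin m → X → ℝ} {x : ℕ → Ω → Fin m → X}

theorem measurable_pair (h : IsRun P σn k m f ε U g x) : Measurable fun ω => (f ω, ε ω) :=
  h.measurable_f.prodMk h.measurable_ε

theorem measurable_draws (h : IsRun P σn k m f ε U g x) (t : ℕ) :
    Measurable fun ω => fun s : Fin t => g s ω :=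
  measurable_pi_iff.2 fun s => h.measurable_g s

theorem isGPModel (h : IsRun P σn k m f ε U g x) (t : ℕ) :
    IsGPModel P σn k f (fun ω (p : Fin t × Fin m) => ε ω p.1 p.2) where
  measurable_f := h.measurable_f
  measurable_e := measurable_pi_iff.2 fun p =>
    (measurable_pi_apply p.2).comp ((measurable_pi_apply (p.1 : ℕ)).comp h.measurable_ε)
  law_f := h.law_f
  law_e p := h.law_ε p.1 p.2
  indep_e := h.indep_ε.precomp (g := fun p : Fin t × Fin m => ((p.1 : ℕ), p.2)) (by
    rintro ⟨a, b⟩ ⟨c, d⟩ hab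
    simpa [Fin.ext_iff] using hab)
  indep := by
    have hψ : Measurable fun (e : ℕ → Fin m → ℝ) (p : Fin t × Fin m) => e p.1 p.2 :=
      measurable_pi_iff.2 fun p => (measurable_pi_apply p.2).comp (measurable_pi_apply (p.1 : ℕ))
    exact h.indep_f_ε.comp measurable_id hψ

/-- The draws of round `t` are i.i.d. from the conditional law of `f` given the history. -/
theorem lintegral_draw (h : IsRun P σn k m f ε U g x) (t : ℕ)
    {Φ : ((X → ℝ) × (ℕ → Fin m → ℝ) × 𝒰 × (Fin t → Fin m → X → ℝ)) × (Fin m → X → ℝ) → ℝ≥0∞}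
    (hΦ : Measurable Φ) :
    ∫⁻ ω, Φ ((f ω, ε ω, U ω, fun s : Fin t => g s ω), g t ω) ∂P =
      ∫⁻ ω, ∫⁻ w, Φ ((f ω, ε ω, U ω, fun s : Fin t => g s ω), w)
        ∂iidKernel (Fin m) (condDistrib f (history f ε x t) P) (history f ε x t ω) ∂P := by
  have hV : Measurable fun ω => (f ω, ε ω, U ω, fun s : Fin t => g s ω) :=
    h.measurable_f.prodMk (h.measurable_ε.prodMk (h.measurable_U.prodMk (h.measurable_draws t)))
  rw [← lintegral_map (f := Φ)
    (g := fun ω => ((f ω, ε ω, U ω, fun s : Fin t => g s ω), g t ω)) hΦ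
    (hV.prodMk (h.measurable_g t)), ← compProd_map_condDistrib (h.measurable_g t).aemeasurable,
    Measure.lintegral_compProd hΦ, lintegral_map hΦ.lintegral_kernel_prod_right' hV]
  refine lintegral_congr_ae ?_
  filter_upwards [h.draws t] with ω hω
  rw [hω]
  rfl

variable [DiscreteMeasurableSpace X]

/-- The design is a measurable function of the unknown function, the noise, the tie-breaking
randomness and the previous draws. -/
theorem exists_design_eq (h : IsRun P σn k m f ε U g x) (t : ℕ) :
    ∃ δ : (X → ℝ) × (ℕ → Fin m → ℝ) × 𝒰 × (Fin t → Fin m → X → ℝ) → Fin t × Fin m → X,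
      Measurable δ ∧ ∀ ω, design x t ω = δ (f ω, ε ω, U ω, fun s : Fin t => g s ω) := by
  induction t with
  | zero =>
    refine ⟨fun _ p => p.1.elim0, measurable_pi_iff.2 fun p => p.1.elim0, fun ω => ?_⟩
    funext p
    exact p.1.elim0
  | succ t ih =>
    obtain ⟨δ, hδ, hδx⟩ := ih
    obtain ⟨φ, hφ, hφx⟩ := h.nonanticipating t
    let pre : (X → ℝ) × (ℕ → Fin m → ℝ) × 𝒰 × (Fin (t + 1) → Fin m → X → ℝ) →
        Fin t × Fin m → X := fun v => δ (v.1, v.2.1, v.2.2.1, fun s => v.2.2.2 s.castSucc)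
    have hpre : Measurable pre := by
      refine hδ.comp (measurable_fst.prodMk (measurable_snd.fst.prodMk
        (measurable_snd.snd.fst.prodMk (measurable_pi_iff.2 fun s => ?_))))
      exact (measurable_pi_apply _).comp measurable_snd.snd.snd
    let nxt : (X → ℝ) × (ℕ → Fin m → ℝ) × 𝒰 × (Fin (t + 1) → Fin m → X → ℝ) → Fin m → X :=
      -- The observed values are recomputed from `f` and the noise at the previous design, so the
      -- recursion closes on `(f, ε, U, g)`.
      fun v => φ (v.2.2.1, (pre v, obsAt (pre v) (v.1, v.2.1)), v.2.2.2)
    have hnxt : Measurable nxt := by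
      refine hφ.comp (measurable_snd.snd.fst.prodMk ((hpre.prodMk ?_).prodMk
        measurable_snd.snd.snd))
      exact measurable_obsAt.comp (hpre.prodMk (measurable_fst.prodMk measurable_snd.fst))
    refine ⟨fun v p => Fin.lastCases (motive := fun _ => X) (nxt v p.2)
      (fun s => pre v (s, p.2)) p.1, measurable_pi_iff.2 ?_, fun ω => funext ?_⟩
    · rintro ⟨s, i⟩
      cases s using Fin.lastCases with
      | last =>
        simp only [Fin.lastCases_last]
        exact (measurable_pi_apply i).comp hnxt
      | cast s =>
        simp only [Fin.lastCases_castSucc]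
        exact (measurable_pi_apply (s, i)).comp hpre
    · rintro ⟨s, i⟩
      have hp : pre (f ω, ε ω, U ω, fun s : Fin (t + 1) => g s ω) = design x t ω :=
        (hδx ω).symm
      cases s using Fin.lastCases with
      | last =>
        simp only [Fin.lastCases_last, nxt, hp]
        exact congrFun (hφx ω) i
      | cast s =>
        simp only [Fin.lastCases_castSucc, hp]
        rfl

theorem measurable_design (h : IsRun P σn k m f ε U g x) (t : ℕ) : Measurable (design x t) := by
  obtain ⟨δ, hδ, hδx⟩ := h.exists_design_eq t
  have : design x t = fun ω => δ (f ω, ε ω, U ω, fun s : Fin t => g s ω) := funext hδx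
  rw [this]
  exact hδ.comp (h.measurable_f.prodMk (h.measurable_ε.prodMk (h.measurable_U.prodMk
    (h.measurable_draws t))))

theorem measurable_history (h : IsRun P σn k m f ε U g x) (t : ℕ) :
    Measurable (history f ε x t) :=
  (h.measurable_design t).prodMk
    (measurable_obsAt.comp ((h.measurable_design t).prodMk h.measurable_pair))

theorem measurable_x (h : IsRun P σn k m f ε U g x) (t : ℕ) : Measurable (x t) := by
  obtain ⟨φ, hφ, hφx⟩ := h.nonanticipating t
  rw [show x t = _ from funext hφx]
  exact hφ.comp (h.measurable_U.prodMk ((h.measurable_history t).prodMk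
    (h.measurable_draws (t + 1))))

theorem measurableSet_design_eq (h : IsRun P σn k m f ε U g x) {t : ℕ} (A : Fin t × Fin m → X) :
    MeasurableSet {ω | design x t ω = A} :=
  h.measurable_design t (MeasurableSet.of_discrete (s := {A}))

/-- Each draw has the same joint law with the history as the unknown function. -/
theorem map_history_draw (h : IsRun P σn k m f ε U g x) (t : ℕ) (i : Fin m) :
    P.map (fun ω => (history f ε x t ω, g t ω i)) = P.map (fun ω => (history f ε x t ω, f ω)) := by
  have hH := h.measurable_history t
  have hgi : Measurable fun ω => g t ω i := (measurable_pi_apply i).comp (h.measurable_g t)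
  obtain ⟨δ, hδ, hδx⟩ := h.exists_design_eq t
  let hist : (X → ℝ) × (ℕ → Fin m → ℝ) × 𝒰 × (Fin t → Fin m → X → ℝ) →
      (Fin t × Fin m → X) × (Fin t × Fin m → ℝ) := fun v => (δ v, obsAt (δ v) (v.1, v.2.1))
  have hhist : Measurable hist :=
    hδ.prodMk (measurable_obsAt.comp (hδ.prodMk (measurable_fst.prodMk measurable_snd.fst)))
  have hhx : ∀ ω, hist (f ω, ε ω, U ω, fun s : Fin t => g s ω) = history f ε x t ω := fun ω => by
    simp only [hist, ← hδx]; rfl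
  refine Measure.ext_of_lintegral _ fun F hF => ?_
  have h1 := h.lintegral_draw t (Φ := fun p => F (hist p.1, p.2 i))
    (hF.comp ((hhist.comp measurable_fst).prodMk ((measurable_pi_apply i).comp measurable_snd)))
  simp only [hhx] at h1
  rw [lintegral_map hF (hH.prodMk hgi), h1, ← compProd_map_condDistrib
    h.measurable_f.aemeasurable, Measure.lintegral_compProd hF,
    lintegral_map hF.lintegral_kernel_prod_right' hH]
  refine lintegral_congr fun ω => ?_
  exact lintegral_iidKernel_eval _ _ i (hF.comp measurable_prodMk_left)

/-- Given everything drawn before, the new samples have a law that depends on the history only. On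
the event that the design is `A`, the history is a function of the observations at `A`, so
`DependsOnlyOn.extend` applies. -/
theorem dependsOnlyOn_of_draw (h : IsRun P σn k m f ε U g x) {t : ℕ} (A : Fin t × Fin m → X)
    (hA : DependsOnlyOn P (fun ω => (f ω, ε ω)) (obsAt A)
      (fun ω => (U ω, fun s : Fin t => g s ω)) {ω | design x t ω = A}) :
    DependsOnlyOn P (fun ω => (f ω, ε ω)) (obsAt A)
      (fun ω => (U ω, fun s : Fin (t + 1) => g s ω)) {ω | design x t ω = A} := by
  obtain ⟨δ, hδ, hδx⟩ := h.exists_design_eq t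
  refine hA.extend (measurable_obsAt_right A) (G := g t)
    ((iidKernel (Fin m) (condDistrib f (history f ε x t) P)).comap (fun y => (A, y))
      measurable_prodMk_left) ?_
    (c := fun p => (p.1.1, Fin.snoc p.1.2 p.2)) ?_ ?_
  · intro Φ hΦ
    have hE := h.measurableSet_design_eq A
    rw [← lintegral_indicator hE, ← lintegral_indicator hE]
    have hre : Measurable fun p : ((X → ℝ) × (ℕ → Fin m → ℝ) × 𝒰 × (Fin t → Fin m → X → ℝ)) ×
        (Fin m → X → ℝ) => Φ (((p.1.1, p.1.2.1), (p.1.2.2.1, p.1.2.2.2)), p.2) := by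
      fun_prop
    have hS : MeasurableSet {p : ((X → ℝ) × (ℕ → Fin m → ℝ) × 𝒰 × (Fin t → Fin m → X → ℝ)) ×
        (Fin m → X → ℝ) | δ p.1 = A} :=
      (hδ.comp measurable_fst) (MeasurableSet.of_discrete (s := {A}))
    have h1 := h.lintegral_draw t (hre.indicator hS)
    refine Eq.trans (lintegral_congr fun ω => ?_) (h1.trans (lintegral_congr fun ω => ?_))
    · simp only [Set.indicator, Set.mem_ofPred_eq, ← hδx]
    · by_cases hω : design x t ω = A
      · have : history f ε x t ω = (A, obsAt A (f ω, ε ω)) := by rw [← hω]; rfl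
        simp only [Set.indicator, Set.mem_ofPred_eq, ← hδx, hω, if_true, this]
        rfl
      · simp only [Set.indicator, Set.mem_ofPred_eq, ← hδx, hω, if_false, lintegral_zero]
  · exact measurable_fst.fst.prodMk (measurable_fin_snoc.comp
      (measurable_fst.snd.prodMk measurable_snd))
  · intro ω
    refine Prod.ext rfl (funext fun s => ?_)
    cases s using Fin.lastCases <;> simp

/-- Induction on the round. The base case is the independence of `U`. In the step, the event splits
into "the earlier design is `A₀`" and "the selection rule returns the last batch of `A`"; the latter
is decided by the observations at `A₀`, `U` and the draws. -/
theorem dependsOnlyOn (h : IsRun P σn k m f ε U g x) (t : ℕ) (A : Fin t × Fin m → X) :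
    DependsOnlyOn P (fun ω => (f ω, ε ω)) (obsAt A)
      (fun ω => (U ω, fun s : Fin t => g s ω)) {ω | design x t ω = A} := by
  induction t with
  | zero =>
    have hE : {ω | design x 0 ω = A} = Set.univ :=
      Set.eq_univ_of_forall fun ω => funext fun p => p.1.elim0
    rw [hE]
    refine DependsOnlyOn.of_indepFun h.measurable_pair
      (h.measurable_U.prodMk (h.measurable_draws 0)) ?_ _
    have : (fun ω => (U ω, fun s : Fin 0 => g s ω)) =
        (fun u : 𝒰 => (u, fun s : Fin 0 => s.elim0)) ∘ U := by
      funext ω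
      exact Prod.ext rfl (funext fun s => s.elim0)
    rw [this]
    exact h.indep_U.comp measurable_id (measurable_id.prodMk measurable_const)
  | succ t ih =>
    obtain ⟨φ, hφ, hφx⟩ := h.nonanticipating t
    let A₀ : Fin t × Fin m → X := fun p => A (p.1.castSucc, p.2)
    let b : Fin m → X := fun i => A (Fin.last t, i)
    have hT : MeasurableSet {p : (Fin t × Fin m → ℝ) × (𝒰 × (Fin (t + 1) → Fin m → X → ℝ)) |
        φ (p.2.1, (A₀, p.1), p.2.2) = b} := by
      have : Measurable fun p : (Fin t × Fin m → ℝ) × (𝒰 × (Fin (t + 1) → Fin m → X → ℝ)) =>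
          φ (p.2.1, (A₀, p.1), p.2.2) := by
        refine hφ.comp ?_
        exact measurable_snd.fst.prodMk ((measurable_const.prodMk measurable_fst).prodMk
          measurable_snd.snd)
      exact this (MeasurableSet.of_discrete (s := {b}))
    have h1 := ((h.dependsOnlyOn_of_draw A₀ (ih A₀)).inter h.measurable_pair
      (measurable_obsAt_right A₀)
      (h.measurable_U.prodMk (h.measurable_draws (t + 1))) hT).of_comp (obs' := obsAt A)
      (c := fun y p => y (p.1.castSucc, p.2))
      (measurable_pi_iff.2 fun p => measurable_pi_apply _) (fun z => rfl)
    convert h1 using 1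
    ext ω
    simp only [Set.mem_ofPred_eq, Set.mem_inter_iff]
    constructor
    · intro hω
      have h2 : design x t ω = A₀ := by
        funext p
        exact congrFun hω (p.1.castSucc, p.2)
      refine ⟨h2, ?_⟩
      have h3 : history f ε x t ω = (A₀, obsAt A₀ (f ω, ε ω)) := by rw [← h2]; rfl
      rw [← h3, ← hφx]
      funext i
      simpa [design] using congrFun hω (Fin.last t, i)
    · rintro ⟨h2, h4⟩
      have h3 : history f ε x t ω = (A₀, obsAt A₀ (f ω, ε ω)) := by rw [← h2]; rfl
      rw [← h3, ← hφx] at h4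
      funext p
      obtain ⟨s, i⟩ := p
      cases s using Fin.lastCases with
      | last => simpa [design] using congrFun h4 i
      | cast s => exact congrFun h2 (s, i)

/-- On the event that the design is `A` and that a further event, determined by the observations,
the tie-breaking randomness and the draws, occurs, the residual of the posterior mean keeps its
law. -/
theorem restrict_map_residual (h : IsRun P σn k m f ε U g x) (hk : (Matrix.of k).PosSemidef)
    (hσn : 0 < σn) {t : ℕ} (A : Fin t × Fin m → X)
    {T : Set ((Fin t × Fin m → ℝ) × (𝒰 × (Fin (t + 1) → Fin m → X → ℝ)))} (hT : MeasurableSet T)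
    {E : Set Ω} (hE : E = {ω | design x t ω = A} ∩
      {ω | (obsAt A (f ω, ε ω), (U ω, fun s : Fin (t + 1) => g s ω)) ∈ T}) (z : X) :
    (P.restrict E).map (fun ω => f ω z - postMean σn k A (obsAt A (f ω, ε ω)) z) =
      P E • gaussianReal 0 (postVar σn k A z).toNNReal := by
  have h1 := (h.dependsOnlyOn_of_draw A (h.dependsOnlyOn t A)).inter h.measurable_pair
    (measurable_obsAt_right A) (h.measurable_U.prodMk (h.measurable_draws (t + 1))) hT
  have hpm : Measurable fun y => postMean σn k A y z := by
    simp_rw [postMean_eq_dotProduct hk hσn, dotProduct]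
    fun_prop
  have hr : Measurable fun v : (X → ℝ) × (ℕ → Fin m → ℝ) =>
      v.1 z - postMean σn k A (obsAt A v) z :=
    ((measurable_pi_apply z).comp measurable_fst).sub (hpm.comp (measurable_obsAt_right A))
  have hind := ((h.isGPModel t).indepFun_residual_obs hk hσn A).comp
    (measurable_pi_apply z) measurable_id
  have h2 := h1.restrict_map (r := fun v => v.1 z - postMean σn k A (obsAt A v) z)
    h.measurable_pair (measurable_obsAt_right A) hr hind
  rw [hE, h2]
  congr 1
  exact (h.isGPModel t).map_residual hk hσn A z

end IsRun

end

end BatchTS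

namespace BatchTS

noncomputable section

/-! ### The sum of posterior variances and the information gain -/

section Deterministic

variable {X : Type*} {k : X → X → ℝ} {σn : ℝ}

theorem infoGain_le_maxInfoGain [Fintype X] [DecidableEq X] {n : ℕ} (A : Fin n → X) :
    infoGain σn k A ≤ maxInfoGain σn k n :=
  le_ciSup (Set.finite_range fun A : Fin n → X => infoGain σn k A).bddAbove A

/-- From `1 - 1/x ≤ log x` at `x = (σₙ² + v) / σₙ²`; the assumption `v ≤ 1` makes the denominator
uniform. -/
theorem div_one_add_sq_le_log {v : ℝ} (hσn : 0 < σn) (hv : 0 ≤ v) (hv1 : v ≤ 1) :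
    v / (1 + σn ^ 2) ≤ Real.log (σn ^ 2 + v) - 2 * Real.log σn := by
  have h2 : 0 < σn ^ 2 := by positivity
  have h := Real.one_sub_inv_le_log_of_pos (x := (σn ^ 2 + v) / σn ^ 2) (by positivity)
  rw [Real.log_div (by positivity) (by positivity), Real.log_pow] at h
  have h3 : 1 - ((σn ^ 2 + v) / σn ^ 2)⁻¹ = v / (σn ^ 2 + v) := by field_simp; ring
  rw [h3] at h
  have h4 : v / (1 + σn ^ 2) ≤ v / (σn ^ 2 + v) :=
    div_le_div_of_nonneg_left hv (by positivity) (by linarith)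
  push_cast at h
  linarith

/-- Along any sequence of batches, the sum of the posterior variances of the chosen points is
controlled by the maximal information gain. -/
theorem sum_postSdGiven_sq_le [Fintype X] [DecidableEq X] (hk : (Matrix.of k).PosSemidef)
    (hσn : 0 < σn) (hk_le : ∀ z z', k z z' ≤ 1) (hk_pos : ∀ z, 0 < k z z)
    {m : ℕ} (b : ℕ → Fin m → X) (T : ℕ) :
    ∑ t ∈ Finset.range T, ∑ i : Fin m, postSdGiven σn k (fun p : Fin t × Fin m => b p.1 p.2)
      (fun j : {j : Fin m // j < i} => b t j) (b t i) ^ 2 ≤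
      2 * (1 + σn ^ 2) * maxInfoGain σn k (T * m) := by
  set v : ℕ → Fin m → ℝ := fun t i => postVar σn k
    (Sum.elim (fun p : Fin t × Fin m => b p.1 p.2) fun j : {j : Fin m // j < i} => b t j) (b t i)
  have hv : ∀ t i, 0 < v t i := fun t i => postVar_pos hk hσn _ (hk_pos _)
  have hv1 : ∀ t i, v t i ≤ 1 := fun t i => (postVar_le_self hk hσn _ _).trans (hk_le _ _)
  have hsd : ∀ t i, postSdGiven σn k (fun p : Fin t × Fin m => b p.1 p.2)
      (fun j : {j : Fin m // j < i} => b t j) (b t i) ^ 2 = v t i := fun t i =>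
    postSd_sq hk hσn _ (hk_pos _)
  simp_rw [hsd]
  let A : Fin (T * m) → X := (fun p : Fin T × Fin m => b p.1 p.2) ∘ finProdFinEquiv.symm
  have h1 := infoGain_le_maxInfoGain (σn := σn) (k := k) A
  -- Chain rule: the log determinant of the full design is the sum of the logarithms of the
  -- successive predictive variances, in the order in which the algorithm picks the points.
  rw [infoGain_eq hk hσn, det_gram_comp_equiv, det_gram_batches hk hσn, Real.log_prod] at h1
  swap
  · exact fun t _ => (Finset.prod_pos fun i _ => add_pos (by positivity) (hv t i)).ne'
  have h2 : ∀ t ∈ Finset.range T, Real.log (∏ i, (σn ^ 2 + v t i)) =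
      ∑ i, Real.log (σn ^ 2 + v t i) := fun t _ =>
    Real.log_prod fun i _ => (add_pos (by positivity) (hv t i)).ne'
  rw [Finset.sum_congr rfl h2] at h1
  have h3 : ∑ t ∈ Finset.range T, ∑ i, v t i / (1 + σn ^ 2) ≤
      ∑ t ∈ Finset.range T, ∑ i, (Real.log (σn ^ 2 + v t i) - 2 * Real.log σn) :=
    Finset.sum_le_sum fun t _ => Finset.sum_le_sum fun i _ =>
      div_one_add_sq_le_log hσn (hv t i).le (hv1 t i)
  simp only [Finset.sum_sub_distrib, Finset.sum_const, Finset.card_univ, Fintype.card_fin,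
    Finset.card_range, nsmul_eq_mul, ← Finset.sum_div] at h3
  push_cast at h1
  rw [div_le_iff₀ (by positivity)] at h3
  have h5 : 0 < 1 + σn ^ 2 := by positivity
  have h6 := mul_le_mul_of_nonneg_left h1 h5.le
  nlinarith

/-! ### Bounds on the ratios -/

theorem sdRatios_le [Fintype X] {ι : Type*} [Fintype ι] [DecidableEq ι]
    (hk : (Matrix.of k).PosSemidef)
    (hσn : 0 < σn) (hk_le : ∀ z z', k z z' ≤ 1) (hk_pos : ∀ z, 0 < k z z) {m : ℕ} {A : ι → X}
    {r : ℝ} (hr : r ∈ sdRatios σn k m A) : r ≤ √(1 + m / σn ^ 2) := by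
  obtain ⟨z, j, hj, B, rfl⟩ := hr
  refine (postSd_div_postSdGiven_le hk hσn hk_le hk_pos A B z).trans (Real.sqrt_le_sqrt ?_)
  rw [Fintype.card_fin]
  gcongr

/-- `sdRatios` is indexed by `Fin j`; this transports other index types, in particular the part of a
batch already chosen. -/
theorem div_mem_sdRatios {ι κ : Type*} [Fintype ι] [DecidableEq ι] [Fintype κ] [DecidableEq κ]
    {m : ℕ} (A : ι → X) (B : κ → X) (hκ : Fintype.card κ ≤ m) (z : X) :
    postSd σn k A z / postSdGiven σn k A B z ∈ sdRatios σn k m A := by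
  refine ⟨z, Fintype.card κ, hκ, B ∘ (Fintype.equivFin κ).symm, ?_⟩
  have : Sum.elim A (B ∘ (Fintype.equivFin κ).symm) =
      Sum.elim A B ∘ (Equiv.sumCongr (Equiv.refl ι) (Fintype.equivFin κ).symm) := by
    funext i
    rcases i with i | i <;> rfl
  rw [postSdGiven, postSdGiven, this, postSd_comp_equiv]

/-- Taking `B` empty. It makes the sets of ratios nonempty and yields `ρ ≥ 1`, which later absorbs
additive constants. -/
theorem one_mem_sdRatios [Fintype X] {ι : Type*} [Fintype ι] [DecidableEq ι]
    (hk : (Matrix.of k).PosSemidef)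
    (hσn : 0 < σn) (hk_pos : ∀ z, 0 < k z z) {m : ℕ} (A : ι → X) (z : X) :
    (1 : ℝ) ∈ sdRatios σn k m A := by
  have h := div_mem_sdRatios (σn := σn) (k := k) (m := m) A (fun e : Empty => e.elim) (by simp) z
  have h2 : postSdGiven σn k A (fun e : Empty => e.elim) z = postSd σn k A z := by
    rw [postSdGiven, ← postSd_comp_equiv A (Equiv.sumEmpty ι Empty)]
    congr 1
    funext i
    rcases i with i | i
    · rfl
    · exact i.elim
  rwa [h2, div_self (postSd_pos hk hσn A (hk_pos z)).ne'] at h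

variable {Ω : Type*} {m : ℕ}

theorem bddAbove_pathRatios [Fintype X] (hk : (Matrix.of k).PosSemidef)
    (hσn : 0 < σn) (hk_le : ∀ z z', k z z' ≤ 1) (hk_pos : ∀ z, 0 < k z z)
    (x : ℕ → Ω → Fin m → X) (T : ℕ) (ω : Ω) :
    BddAbove {r | ∃ τ < T, r ∈ sdRatios σn k m (design x τ ω)} := by
  refine ⟨√(1 + m / σn ^ 2), ?_⟩
  rintro r ⟨τ, -, hr⟩
  exact sdRatios_le hk hσn hk_le hk_pos hr

theorem rhoPath_le [Fintype X] (hk : (Matrix.of k).PosSemidef)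
    (hσn : 0 < σn) (hk_le : ∀ z z', k z z' ≤ 1) (hk_pos : ∀ z, 0 < k z z)
    (x : ℕ → Ω → Fin m → X) (T : ℕ) (ω : Ω) : rhoPath σn k x T ω ≤ √(1 + m / σn ^ 2) := by
  refine Real.sSup_le ?_ (Real.sqrt_nonneg _)
  rintro r ⟨τ, -, hr⟩
  exact sdRatios_le hk hσn hk_le hk_pos hr

theorem one_le_rhoPath [Fintype X] [Nonempty X] (hk : (Matrix.of k).PosSemidef)
    (hσn : 0 < σn) (hk_le : ∀ z z', k z z' ≤ 1) (hk_pos : ∀ z, 0 < k z z)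
    (x : ℕ → Ω → Fin m → X) {T : ℕ} (hT : 1 ≤ T) (ω : Ω) : 1 ≤ rhoPath σn k x T ω :=
  le_csSup (bddAbove_pathRatios hk hσn hk_le hk_pos x T ω)
    ⟨0, hT, one_mem_sdRatios hk hσn hk_pos _ (Classical.arbitrary X)⟩

theorem rhoPath_le_rho [Fintype X] [Nonempty X] (hk : (Matrix.of k).PosSemidef)
    (hσn : 0 < σn) (hk_le : ∀ z z', k z z' ≤ 1) (hk_pos : ∀ z, 0 < k z z)
    (x : ℕ → Ω → Fin m → X) {T : ℕ} (hT : 1 ≤ T) (ω : Ω) :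
    rhoPath σn k x T ω ≤ rho σn k T m := by
  refine csSup_le_csSup ⟨√(1 + m / σn ^ 2), ?_⟩
    ⟨1, 0, hT, one_mem_sdRatios hk hσn hk_pos _ (Classical.arbitrary X)⟩ ?_
  · rintro r ⟨τ, -, A, hr⟩
    exact sdRatios_le hk hσn hk_le hk_pos hr
  · rintro r ⟨τ, hτ, hr⟩
    exact ⟨τ, hτ, _, hr⟩

theorem postSd_div_postSdGiven_le_rhoPath [Fintype X] (hk : (Matrix.of k).PosSemidef)
    (hσn : 0 < σn) (hk_le : ∀ z z', k z z' ≤ 1) (hk_pos : ∀ z, 0 < k z z)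
    (x : ℕ → Ω → Fin m → X) {T t : ℕ} (ht : t < T) (ω : Ω) (i : Fin m) (z : X) :
    postSd σn k (design x t ω) z /
      postSdGiven σn k (design x t ω) (fun j : {j : Fin m // j < i} => x t ω j) z ≤
      rhoPath σn k x T ω :=
  le_csSup (bddAbove_pathRatios hk hσn hk_le hk_pos x T ω)
    ⟨t, ht, div_mem_sdRatios _ _ ((Fintype.card_subtype_le _).trans (by simp)) z⟩

/-- Only the first `T` rounds enter, so `rhoPath` factors through a design in a finite type; this is
how its measurability is obtained. -/
theorem rhoPath_eq_of_design_eq {Ω' : Type*} {x : ℕ → Ω → Fin m → X} {x' : ℕ → Ω' → Fin m → X}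
    {T : ℕ} {ω : Ω} {ω' : Ω'} (h : ∀ t < T, x t ω = x' t ω') :
    rhoPath σn k x T ω = rhoPath σn k x' T ω' := by
  unfold rhoPath
  congr 1
  ext r
  refine exists_congr fun τ => and_congr_right fun hτ => ?_
  have : design x τ ω = design x' τ ω' := by
    funext p
    simp only [design, h p.1 (p.1.2.trans hτ)]
  rw [this]

/-! ### The excess of the Regret-to-Sigma Ratio -/

/-- A minimizer `y` of the Regret-to-Sigma Ratio satisfies
`v* - μ(y) ≤ σ(y) ρ (β + ∑ z, (|v z - μ z| / s z - β)⁺)`. -/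
theorem sup_sub_le_of_argmin [Fintype X] [Nonempty X] {v μ s sd : X → ℝ} {ρ β : ℝ} {y : X}
    (hs : ∀ z, 0 < s z) (hsd : ∀ z, 0 < sd z) (hρ : ∀ z, s z / sd z ≤ ρ)
    (hy : ∀ z, ((⨆ z', v z') - μ y) / sd y ≤ ((⨆ z', v z') - μ z) / sd z) :
    (⨆ z', v z') - μ y ≤ sd y * (ρ * (β + ∑ z, max (|(v z - μ z) / s z| - β) 0)) := by
  -- The minimizer is compared with the maximizer `z` of the draw, where the numerator is the
  -- residual `v z - μ z`. Since `z` is random, its excess is bounded by the sum over all points.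
  obtain ⟨z, hz⟩ := exists_eq_ciSup_of_finite (f := v)
  have h1 := hy z
  rw [← hz] at h1 ⊢
  rw [div_le_iff₀ (hsd y)] at h1
  refine h1.trans ?_
  rw [mul_comm]
  refine mul_le_mul_of_nonneg_left ?_ (hsd y).le
  have h2 : (v z - μ z) / sd z = s z / sd z * ((v z - μ z) / s z) := by
    have := (hs z).ne'
    have := (hsd z).ne'
    field_simp
  have h3 : |(v z - μ z) / s z| ≤ β + ∑ z, max (|(v z - μ z) / s z| - β) 0 := by
    have h4 : max (|(v z - μ z) / s z| - β) 0 ≤ ∑ z, max (|(v z - μ z) / s z| - β) 0 :=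
      Finset.single_le_sum (f := fun z => max (|(v z - μ z) / s z| - β) 0)
        (fun _ _ => le_max_right _ _) (Finset.mem_univ z)
    have := le_max_left (|(v z - μ z) / s z| - β) 0
    linarith
  rw [h2]
  have h5 : 0 < s z / sd z := div_pos (hs z) (hsd z)
  calc s z / sd z * ((v z - μ z) / s z) ≤ s z / sd z * |(v z - μ z) / s z| :=
        mul_le_mul_of_nonneg_left (le_abs_self _) h5.le
    _ ≤ ρ * (β + ∑ z, max (|(v z - μ z) / s z| - β) 0) :=
        mul_le_mul (hρ z) h3 (abs_nonneg _) (h5.le.trans (hρ z))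

end Deterministic

/-! ### Gaussian tails -/

/-- Chernoff's device: `u ≤ exp u` at `u = β (|s| - β)`, then `exp (β |s|) ≤ exp (β s) + exp (-β
s)`. Under `N(0, 1)` both exponentials have mean `exp (β² / 2)`. -/
theorem max_abs_sub_le_exp {β : ℝ} (hβ : 0 < β) (s : ℝ) :
    max (|s| - β) 0 ≤ (Real.exp (-β ^ 2) / β) * (Real.exp (β * s) + Real.exp (-β * s)) := by
  have hpos : 0 ≤ (Real.exp (-β ^ 2) / β) * (Real.exp (β * s) + Real.exp (-β * s)) := by positivity
  refine max_le ?_ hpos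
  have h1 : β * (|s| - β) ≤ Real.exp (β * (|s| - β)) := by
    have := Real.add_one_le_exp (β * (|s| - β)); linarith
  have h2 : Real.exp (β * (|s| - β)) = Real.exp (-β ^ 2) * Real.exp (β * |s|) := by
    rw [← Real.exp_add]; ring_nf
  have h3 : Real.exp (β * |s|) ≤ Real.exp (β * s) + Real.exp (-β * s) := by
    rcases abs_cases s with ⟨h, -⟩ | ⟨h, -⟩ <;> rw [h]
    · linarith [Real.exp_pos (-β * s)]
    · rw [show β * -s = -β * s by ring]; linarith [Real.exp_pos (β * s)]
  rw [div_mul_eq_mul_div, le_div_iff₀ hβ]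
  have := mul_le_mul_of_nonneg_left h3 (Real.exp_pos (-β ^ 2)).le
  linarith

theorem integrable_max_abs_sub {β : ℝ} (hβ : 0 < β) :
    Integrable (fun s => max (|s| - β) 0) (gaussianReal 0 1) := by
  refine Integrable.mono' (((integrable_exp_mul_gaussianReal β).add
    (integrable_exp_mul_gaussianReal (-β))).const_mul (Real.exp (-β ^ 2) / β))
    (by fun_prop) (Filter.Eventually.of_forall fun s => ?_)
  rw [Real.norm_of_nonneg (le_max_right _ _)]
  exact max_abs_sub_le_exp hβ s

theorem integral_max_abs_sub_le {β : ℝ} (hβ : 0 < β) :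
    ∫ s, max (|s| - β) 0 ∂(gaussianReal 0 1) ≤ 2 / β * Real.exp (-(β ^ 2 / 2)) := by
  have hi := integrable_exp_mul_gaussianReal (μ := 0) (v := 1) β
  have hi' := integrable_exp_mul_gaussianReal (μ := 0) (v := 1) (-β)
  have hm : ∀ t, ∫ s, Real.exp (t * s) ∂(gaussianReal 0 1) = Real.exp (t ^ 2 / 2) := fun t => by
    have := congrFun (mgf_id_gaussianReal (μ := 0) (v := 1)) t
    simpa [mgf] using this
  have hs : Integrable (fun s => Real.exp (β * s) + Real.exp (-β * s)) (gaussianReal 0 1) :=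
    hi.add hi'
  refine (integral_mono (integrable_max_abs_sub hβ) (hs.const_mul _)
    fun s => max_abs_sub_le_exp hβ s).trans ?_
  rw [integral_const_mul, integral_add hi hi', hm, hm, neg_sq, ← two_mul]
  have : Real.exp (-(β ^ 2 / 2)) = Real.exp (-β ^ 2) * Real.exp (β ^ 2 / 2) := by
    rw [← Real.exp_add]; ring_nf
  rw [this]
  apply le_of_eq
  ring

end

end BatchTS

namespace BatchTS

noncomputable section

/-! ### Standardized residuals -/

theorem measurable_postMean {X : Type*} [Fintype X] [MeasurableSpace X] [DiscreteMeasurableSpace X]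
    {ι : Type*} [Fintype ι] [DecidableEq ι] {k : X → X → ℝ} {σn : ℝ}
    (hk : (Matrix.of k).PosSemidef) (hσn : 0 < σn) :
    Measurable fun p : ((ι → X) × (ι → ℝ)) × X => postMean σn k p.1.1 p.1.2 p.2 := by
  have h : ∀ z, Measurable fun p : (ι → X) × (ι → ℝ) => postMean σn k p.1 p.2 z := fun z => by
    refine measurable_from_prod_countable_right fun A => ?_
    simp_rw [postMean_eq_dotProduct hk hσn, dotProduct]
    fun_prop
  exact measurable_from_prod_countable_left h

/-- The deviation of `v z` from the posterior mean given the data `p`, in units of the posterior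
standard deviation. -/
def stdResidual {X ι : Type*} [Fintype ι] [DecidableEq ι] (σn : ℝ) (k : X → X → ℝ)
    (p : (ι → X) × (ι → ℝ)) (v : X → ℝ) (z : X) : ℝ :=
  (v z - postMean σn k p.1 p.2 z) / postSd σn k p.1 z

theorem measurable_stdResidual {X : Type*} [Fintype X] [MeasurableSpace X]
    [DiscreteMeasurableSpace X] {ι : Type*} [Fintype ι] [DecidableEq ι] {k : X → X → ℝ} {σn : ℝ}
    (hk : (Matrix.of k).PosSemidef) (hσn : 0 < σn) (z : X) :
    Measurable fun p : ((ι → X) × (ι → ℝ)) × (X → ℝ) => stdResidual σn k p.1 p.2 z := by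
  refine Measurable.div (Measurable.sub ((measurable_pi_apply z).comp measurable_snd)
    ((measurable_postMean hk hσn).comp (measurable_fst.prodMk measurable_const))) ?_
  exact (Measurable.of_discrete (f := fun A : ι → X => postSd σn k A z)).comp measurable_fst.fst

theorem measurable_ciSup_pi {X : Type*} [Fintype X] [Nonempty X] :
    Measurable fun v : X → ℝ => ⨆ z, v z :=
  Measurable.iSup fun z => measurable_pi_apply z

theorem abs_ciSup_le_sum {X : Type*} [Fintype X] [Nonempty X] (v : X → ℝ) :
    |⨆ z, v z| ≤ ∑ z, |v z| := by
  obtain ⟨z, hz⟩ := exists_eq_ciSup_of_finite (f := v)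
  rw [← hz]
  exact Finset.single_le_sum (f := fun z => |v z|) (fun _ _ => abs_nonneg _) (Finset.mem_univ z)

/-- Splits a residual at random points into finitely many pieces, on each of which the design and
the evaluation point are fixed. -/
theorem residual_eval_eq_sum {Ω X : Type*} [Fintype X] [DecidableEq X] {σn : ℝ}
    {k : X → X → ℝ} {m : ℕ} (f : Ω → X → ℝ) (ε : Ω → ℕ → Fin m → ℝ) (x : ℕ → Ω → Fin m → X)
    (t : ℕ) (i : Fin m) (ω : Ω) :
    f ω (x t ω i) - postMean σn k (design x t ω) (observed f ε x t ω) (x t ω i) =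
      ∑ A : Fin t × Fin m → X, ∑ z, ({ω | design x t ω = A} ∩ {ω | x t ω i = z}).indicator
        (fun ω => f ω z - postMean σn k A (obsAt A (f ω, ε ω)) z) ω := by
  rw [Finset.sum_eq_single (design x t ω), Finset.sum_eq_single (x t ω i)]
  · have hω : ω ∈ {ω' | design x t ω' = design x t ω} ∩ {ω' | x t ω' i = x t ω i} := ⟨rfl, rfl⟩
    rw [Set.indicator_of_mem hω]
    rfl
  · exact fun z _ hz => Set.indicator_of_notMem (fun hω => hz hω.2.symm) _
  · simp
  · exact fun A _ hA => Finset.sum_eq_zero fun z _ =>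
      Set.indicator_of_notMem (fun hω => hA hω.1.symm) _
  · simp

namespace IsRun

variable {Ω X 𝒰 : Type*} [MeasurableSpace Ω] [Fintype X] [DecidableEq X] [MeasurableSpace X]
  [MeasurableSpace 𝒰] {P : Measure Ω} [IsProbabilityMeasure P]
  {σn : ℝ} {k : X → X → ℝ} {m : ℕ} {f : Ω → X → ℝ} {ε : Ω → ℕ → Fin m → ℝ} {U : Ω → 𝒰}
  {g : ℕ → Ω → Fin m → X → ℝ} {x : ℕ → Ω → Fin m → X}

theorem measurable_draw (h : IsRun P σn k m f ε U g x) (t : ℕ) (i : Fin m) :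
    Measurable fun ω => g t ω i :=
  (measurable_pi_apply i).comp (h.measurable_g t)

theorem integrable_sum_abs (h : IsRun P σn k m f ε U g x) :
    Integrable (fun ω => ∑ z, |f ω z|) P :=
  integrable_finsetSum _ fun z _ => (((h.isGPModel 0).memLp_f z).integrable (by simp)).abs

theorem integrable_residual (h : IsRun P σn k m f ε U g x) (hk : (Matrix.of k).PosSemidef)
    (hσn : 0 < σn) {t : ℕ} (A : Fin t × Fin m → X) (z : X) :
    Integrable (fun ω => f ω z - postMean σn k A (obsAt A (f ω, ε ω)) z) P :=
  ((h.isGPModel t).memLp_residual hk hσn A z).integrable (by simp)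

theorem integrable_iSup [Nonempty X] (h : IsRun P σn k m f ε U g x) :
    Integrable (fun ω => ⨆ z, f ω z) P :=
  h.integrable_sum_abs.mono' (measurable_ciSup_pi.comp h.measurable_f).aestronglyMeasurable
    (Filter.Eventually.of_forall fun ω => abs_ciSup_le_sum (f ω))

variable [DiscreteMeasurableSpace X]

/-- On each event that the design is `A`, the residual is `N(0, σ_A(z)²)` up to the mass of the
event. Dividing by `σ_A(z)` removes the dependence on `A`, and the pieces add up. -/
theorem map_stdResidual (h : IsRun P σn k m f ε U g x) (hk : (Matrix.of k).PosSemidef)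
    (hσn : 0 < σn) (hk_pos : ∀ z, 0 < k z z) (t : ℕ) (z : X) :
    P.map (fun ω => stdResidual σn k (history f ε x t ω) (f ω) z) = gaussianReal 0 1 := by
  have hm : Measurable fun ω => stdResidual σn k (history f ε x t ω) (f ω) z :=
    (measurable_stdResidual hk hσn z).comp ((h.measurable_history t).prodMk h.measurable_f)
  ext S hS
  rw [Measure.map_apply hm hS]
  have key : ∀ A : Fin t × Fin m → X,
      P ((fun ω => stdResidual σn k (history f ε x t ω) (f ω) z) ⁻¹' S ∩ design x t ⁻¹' {A}) =
        P (design x t ⁻¹' {A}) * gaussianReal 0 1 S := fun A => by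
    have h1 := h.restrict_map_residual hk hσn A MeasurableSet.univ (E := design x t ⁻¹' {A})
      (by simp; rfl) z
    have hs : Measurable fun v : ℝ => v / postSd σn k A z := by fun_prop
    have hpm : Measurable fun y : Fin t × Fin m → ℝ => postMean σn k A y z := by
      simp_rw [postMean_eq_dotProduct hk hσn, dotProduct]
      fun_prop
    have hr : Measurable fun ω => f ω z - postMean σn k A (obsAt A (f ω, ε ω)) z :=
      ((measurable_pi_apply z).comp h.measurable_f).sub
        (hpm.comp ((measurable_obsAt_right A).comp h.measurable_pair))
    have h2 := congrArg (fun ν => Measure.map (fun v : ℝ => v / postSd σn k A z) ν S) h1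
    rw [Measure.map_map hs hr, Measure.map_smul, gaussianReal_map_div_const,
      Measure.map_apply (hs.comp hr) hS,
      Measure.restrict_apply (hs.comp hr hS), Measure.smul_apply, smul_eq_mul] at h2
    have h3 : (postVar σn k A z).toNNReal / NNReal.mk (postSd σn k A z ^ 2) (sq_nonneg _) = 1 := by
      have : NNReal.mk (postSd σn k A z ^ 2) (sq_nonneg _) = (postVar σn k A z).toNNReal := by
        ext
        rw [Real.coe_toNNReal _ (postVar_pos hk hσn A (hk_pos z)).le]
        exact postSd_sq hk hσn A (hk_pos z)
      rw [this, div_self]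
      exact (Real.toNNReal_pos.2 (postVar_pos hk hσn A (hk_pos z))).ne'
    rw [zero_div, h3] at h2
    rw [← h2]
    congr 1
    ext ω
    simp only [Set.mem_inter_iff, Set.mem_preimage, Set.mem_singleton_iff, Function.comp]
    refine and_congr_left fun hω => ?_
    have : history f ε x t ω = (A, obsAt A (f ω, ε ω)) := by rw [← hω]; rfl
    rw [this]
    rfl
  have hsum : ∀ B : Set Ω, MeasurableSet B →
      ∑ A : Fin t × Fin m → X, P (B ∩ design x t ⁻¹' {A}) = P B := fun B hB => by
    have := sum_measure_preimage_singleton (μ := P.restrict B) (f := design x t) Finset.univ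
      (fun A _ => h.measurableSet_design_eq A)
    simp only [Finset.coe_univ, Set.preimage_univ, Measure.restrict_apply_univ] at this
    rw [← this]
    refine Finset.sum_congr rfl fun A _ => ?_
    rw [Measure.restrict_apply (h.measurable_design t MeasurableSet.of_discrete), Set.inter_comm]
  rw [← hsum _ (hm hS), Finset.sum_congr rfl fun A _ => key A, ← Finset.sum_mul]
  have h1 := hsum Set.univ MeasurableSet.univ
  simp only [Set.univ_inter, measure_univ] at h1
  rw [h1, one_mul]

theorem map_stdResidual_draw (h : IsRun P σn k m f ε U g x) (hk : (Matrix.of k).PosSemidef)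
    (hσn : 0 < σn) (hk_pos : ∀ z, 0 < k z z) (t : ℕ) (i : Fin m) (z : X) :
    P.map (fun ω => stdResidual σn k (history f ε x t ω) (g t ω i) z) = gaussianReal 0 1 := by
  rw [← h.map_stdResidual hk hσn hk_pos t z]
  have hm := measurable_stdResidual (ι := Fin t × Fin m) hk hσn z
  have h1 := congrArg (Measure.map fun p : ((Fin t × Fin m → X) × (Fin t × Fin m → ℝ)) ×
    (X → ℝ) => stdResidual σn k p.1 p.2 z) (h.map_history_draw t i)
  rwa [Measure.map_map hm ((h.measurable_history t).prodMk
    (h.measurable_draw t i)),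
    Measure.map_map hm ((h.measurable_history t).prodMk h.measurable_f)] at h1

theorem map_draw (h : IsRun P σn k m f ε U g x) (t : ℕ) (i : Fin m) :
    P.map (fun ω => g t ω i) = P.map f := by
  have h1 := congrArg (Measure.map Prod.snd) (h.map_history_draw t i)
  rwa [Measure.map_map measurable_snd ((h.measurable_history t).prodMk
    (h.measurable_draw t i)),
    Measure.map_map measurable_snd ((h.measurable_history t).prodMk h.measurable_f)] at h1

/-! ### Integrability and expectations along a run -/

theorem integrable_iSup_draw [Nonempty X] (h : IsRun P σn k m f ε U g x) (t : ℕ) (i : Fin m) :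
    Integrable (fun ω => ⨆ z, g t ω i z) P := by
  have h1 : Integrable (fun v : X → ℝ => ⨆ z, v z) (P.map f) :=
    (integrable_map_measure measurable_ciSup_pi.aestronglyMeasurable
      h.measurable_f.aemeasurable).2 h.integrable_iSup
  rw [← h.map_draw t i] at h1
  exact (integrable_map_measure measurable_ciSup_pi.aestronglyMeasurable
    (h.measurable_draw t i).aemeasurable).1 h1

theorem integral_iSup_draw [Nonempty X] (h : IsRun P σn k m f ε U g x) (t : ℕ) (i : Fin m) :
    ∫ ω, ⨆ z, g t ω i z ∂P = ∫ ω, ⨆ z, f ω z ∂P := by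
  have h1 := integral_map (μ := P) (h.measurable_draw t i).aemeasurable
    (measurable_ciSup_pi (X := X)).aestronglyMeasurable
  have h2 := integral_map (μ := P) h.measurable_f.aemeasurable
    (measurable_ciSup_pi (X := X)).aestronglyMeasurable
  rw [← h1, ← h2, h.map_draw t i]

theorem integrable_eval (h : IsRun P σn k m f ε U g x) (t : ℕ) (i : Fin m) :
    Integrable (fun ω => f ω (x t ω i)) P := by
  have hev : Measurable fun p : (X → ℝ) × X => p.1 p.2 :=
    measurable_from_prod_countable_left fun a => measurable_pi_apply a
  refine h.integrable_sum_abs.mono' (hev.comp (h.measurable_f.prodMk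
    ((measurable_pi_apply i).comp (h.measurable_x t)))).aestronglyMeasurable
    (Filter.Eventually.of_forall fun ω => ?_)
  exact Finset.single_le_sum (f := fun z => |f ω z|) (fun _ _ => abs_nonneg _) (Finset.mem_univ _)

theorem integrable_regret [Nonempty X] (h : IsRun P σn k m f ε U g x) (T : ℕ) :
    Integrable (regret f x T) P :=
  integrable_finsetSum _ fun t _ => integrable_finsetSum _ fun i _ =>
    h.integrable_iSup.sub (h.integrable_eval t i)

/-- Once the design is fixed, the choice `x t ω i = z` is decided by the observations, `U` and the
draws, so the residual stays centered on this event. -/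
theorem setIntegral_residual (h : IsRun P σn k m f ε U g x) (hk : (Matrix.of k).PosSemidef)
    (hσn : 0 < σn) {t : ℕ} (i : Fin m) (A : Fin t × Fin m → X) (z : X) :
    ∫ ω in {ω | design x t ω = A} ∩ {ω | x t ω i = z},
      (f ω z - postMean σn k A (obsAt A (f ω, ε ω)) z) ∂P = 0 := by
  obtain ⟨φ, hφ, hφx⟩ := h.nonanticipating t
  have hT : MeasurableSet {p : (Fin t × Fin m → ℝ) × (𝒰 × (Fin (t + 1) → Fin m → X → ℝ)) |
      φ (p.2.1, (A, p.1), p.2.2) i = z} := by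
    have : Measurable fun p : (Fin t × Fin m → ℝ) × (𝒰 × (Fin (t + 1) → Fin m → X → ℝ)) =>
        φ (p.2.1, (A, p.1), p.2.2) i :=
      (measurable_pi_apply i).comp (hφ.comp (measurable_snd.fst.prodMk
        ((measurable_const.prodMk measurable_fst).prodMk measurable_snd.snd)))
    exact this (MeasurableSet.of_discrete (s := {z}))
  have h1 := h.restrict_map_residual hk hσn A hT
    (E := {ω | design x t ω = A} ∩ {ω | x t ω i = z}) (by
      ext ω
      simp only [Set.mem_inter_iff, Set.mem_ofPred_eq]
      refine and_congr_right fun hω => ?_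
      have : history f ε x t ω = (A, obsAt A (f ω, ε ω)) := by rw [← hω]; rfl
      rw [← this, ← hφx]) z
  have hr := ((h.isGPModel t).memLp_residual hk hσn
    A z).aestronglyMeasurable.aemeasurable.mono_measure
    (Measure.restrict_le_self (s := {ω | design x t ω = A} ∩ {ω | x t ω i = z}))
  have h2 := integral_map (f := fun v : ℝ => v) hr aestronglyMeasurable_id
  refine h2.symm.trans ?_
  refine (congrArg (fun ν => ∫ v, v ∂ν) h1).trans ?_
  simp only [integral_smul_measure, integral_id_gaussianReal, smul_zero]

theorem measurableSet_design_inter (h : IsRun P σn k m f ε U g x) {t : ℕ} (i : Fin m)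
    (A : Fin t × Fin m → X) (z : X) :
    MeasurableSet ({ω | design x t ω = A} ∩ {ω | x t ω i = z}) :=
  (h.measurableSet_design_eq A).inter (((measurable_pi_apply i).comp (h.measurable_x t))
    (MeasurableSet.of_discrete (s := {z})))

theorem integrable_residual_eval (h : IsRun P σn k m f ε U g x) (hk : (Matrix.of k).PosSemidef)
    (hσn : 0 < σn) (t : ℕ) (i : Fin m) :
    Integrable (fun ω => f ω (x t ω i) -
      postMean σn k (design x t ω) (observed f ε x t ω) (x t ω i)) P := by
  simp_rw [residual_eval_eq_sum f ε x]
  exact integrable_finsetSum _ fun A _ => integrable_finsetSum _ fun z _ =>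
    (h.integrable_residual hk hσn A z).indicator (h.measurableSet_design_inter i A z)

theorem integral_residual_eval (h : IsRun P σn k m f ε U g x) (hk : (Matrix.of k).PosSemidef)
    (hσn : 0 < σn) (t : ℕ) (i : Fin m) :
    ∫ ω, (f ω (x t ω i) -
      postMean σn k (design x t ω) (observed f ε x t ω) (x t ω i)) ∂P = 0 := by
  simp_rw [residual_eval_eq_sum f ε x]
  have hI : ∀ (A : Fin t × Fin m → X) z, Integrable
      (({ω | design x t ω = A} ∩ {ω | x t ω i = z}).indicator
        (fun ω => f ω z - postMean σn k A (obsAt A (f ω, ε ω)) z)) P := fun A z =>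
    (h.integrable_residual hk hσn A z).indicator (h.measurableSet_design_inter i A z)
  rw [integral_finsetSum _ fun A _ => integrable_finsetSum _ fun z _ => hI A z]
  refine Finset.sum_eq_zero fun A _ => ?_
  rw [integral_finsetSum _ fun z _ => hI A z]
  refine Finset.sum_eq_zero fun z _ => ?_
  rw [integral_indicator (h.measurableSet_design_inter i A z)]
  exact h.setIntegral_residual hk hσn i A z

/-- The excess of the sampled maximum over the posterior mean at the chosen point. -/
theorem integrable_iSup_draw_sub_postMean [Nonempty X] (h : IsRun P σn k m f ε U g x)
    (hk : (Matrix.of k).PosSemidef) (hσn : 0 < σn) (t : ℕ) (i : Fin m) :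
    Integrable (fun ω => (⨆ z, g t ω i z) -
      postMean σn k (design x t ω) (observed f ε x t ω) (x t ω i)) P := by
  -- The posterior mean at the chosen point is written as `f` there minus the residual, both
  -- integrable.
  have := (h.integrable_iSup_draw t i).sub
    ((h.integrable_eval t i).sub (h.integrable_residual_eval hk hσn t i))
  simpa [Pi.sub_def] using this

/-- The expected regret is the expected sum of the excesses of the sampled maxima over the
posterior means at the chosen points. -/
theorem integral_regret_eq [Nonempty X] (h : IsRun P σn k m f ε U g x)
    (hk : (Matrix.of k).PosSemidef) (hσn : 0 < σn) (T : ℕ) :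
    ∫ ω, regret f x T ω ∂P = ∫ ω, ∑ t ∈ Finset.range T, ∑ i : Fin m, ((⨆ z, g t ω i z) -
      postMean σn k (design x t ω) (observed f ε x t ω) (x t ω i)) ∂P := by
  have hI := fun t i => h.integrable_iSup_draw_sub_postMean hk hσn t i
  have hI' : ∀ t i, Integrable (fun ω => (⨆ z, f ω z) - f ω (x t ω i)) P := fun t i =>
    h.integrable_iSup.sub (h.integrable_eval t i)
  unfold regret
  rw [integral_finsetSum _ fun t _ => integrable_finsetSum _ fun i _ => hI t i,
    integral_finsetSum _ fun t _ => integrable_finsetSum _ fun i _ => hI' t i]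
  refine Finset.sum_congr rfl fun t _ => ?_
  rw [integral_finsetSum _ fun i _ => hI t i, integral_finsetSum _ fun i _ => hI' t i]
  refine Finset.sum_congr rfl fun i _ => ?_
  have h0 : ∫ ω, (((⨆ z, g t ω i z) -
      postMean σn k (design x t ω) (observed f ε x t ω) (x t ω i)) -
      (f ω (x t ω i) - postMean σn k (design x t ω) (observed f ε x t ω) (x t ω i))) ∂P =
      ∫ ω, ((⨆ z, g t ω i z) - f ω (x t ω i)) ∂P := by
    congr 1
    funext ω
    ring
  rw [integral_sub (hI t i) (h.integrable_residual_eval hk hσn t i),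
    h.integral_residual_eval hk hσn t i, sub_zero,
    integral_sub (h.integrable_iSup_draw t i) (h.integrable_eval t i),
    h.integral_iSup_draw t i] at h0
  rw [integral_sub h.integrable_iSup (h.integrable_eval t i), h0]

theorem integrable_rhoPath [Nonempty X] (h : IsRun P σn k m f ε U g x)
    (hk : (Matrix.of k).PosSemidef) (hσn : 0 < σn) (hk_le : ∀ z z', k z z' ≤ 1)
    (hk_pos : ∀ z, 0 < k z z) {T : ℕ} (hT : 1 ≤ T) : Integrable (rhoPath σn k x T) P := by
  -- A run rebuilt from its design. Its values from round `T` on are arbitrary and do not affect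
  -- `rhoPath`.
  let x' : ℕ → (Fin T × Fin m → X) → Fin m → X := fun t A i =>
    if ht : t < T then A (⟨t, ht⟩, i) else Classical.arbitrary X
  have h1 : rhoPath σn k x T = rhoPath σn k x' T ∘ design x T := by
    funext ω
    refine rhoPath_eq_of_design_eq fun t ht => ?_
    funext i
    simp [x', ht, design]
  have hm : Measurable (rhoPath σn k x T) := by
    rw [h1]
    exact Measurable.of_discrete.comp (h.measurable_design T)
  refine Integrable.of_bound hm.aestronglyMeasurable (√(1 + m / σn ^ 2))
    (Filter.Eventually.of_forall fun ω => ?_)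
  rw [Real.norm_of_nonneg (zero_le_one.trans (one_le_rhoPath hk hσn hk_le hk_pos x hT ω))]
  exact rhoPath_le hk hσn hk_le hk_pos x T ω

end IsRun

end

end BatchTS

namespace BatchTS

noncomputable section

/-! ### The regret bound -/

/-- Along any sequence of batches, the sum of the posterior standard deviations of the chosen
points is controlled by the maximal information gain. -/
theorem sum_postSdGiven_le {X : Type*} [Fintype X] [DecidableEq X] {k : X → X → ℝ} {σn : ℝ}
    (hk : (Matrix.of k).PosSemidef) (hσn : 0 < σn)
    (hk_le : ∀ z z', k z z' ≤ 1) (hk_pos : ∀ z, 0 < k z z) {m : ℕ} (b : ℕ → Fin m → X) (T : ℕ) :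
    ∑ t ∈ Finset.range T, ∑ i : Fin m, postSdGiven σn k (fun p : Fin t × Fin m => b p.1 p.2)
      (fun j : {j : Fin m // j < i} => b t j) (b t i) ≤
      √(2 * (1 + σn ^ 2)) * √((T * m : ℕ) * maxInfoGain σn k (T * m)) := by
  have h1 := sum_postSdGiven_sq_le hk hσn hk_le hk_pos b T
  rw [← Finset.sum_product'] at h1 ⊢
  have h2 := sq_sum_le_card_mul_sum_sq (s := Finset.range T ×ˢ (Finset.univ : Finset (Fin m)))
    (f := fun p => postSdGiven σn k (fun q : Fin p.1 × Fin m => b q.1 q.2)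
      (fun j : {j : Fin m // j < p.2} => b p.1 j) (b p.1 p.2))
  rw [Finset.card_product, Finset.card_range, Finset.card_univ, Fintype.card_fin] at h2
  rw [← Real.sqrt_mul (by positivity)]
  refine Real.le_sqrt_of_sq_le (h2.trans ?_)
  have h3 := mul_le_mul_of_nonneg_left h1 (Nat.cast_nonneg (α := ℝ) (T * m))
  linarith

/-- The total amount by which the standardized residuals of the draws exceed `β`. -/
def excess {Ω X : Type*} [Fintype X] {m : ℕ} (σn : ℝ) (k : X → X → ℝ) (f : Ω → X → ℝ)
    (ε : Ω → ℕ → Fin m → ℝ) (g : ℕ → Ω → Fin m → X → ℝ) (x : ℕ → Ω → Fin m → X)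
    (β : ℝ) (T : ℕ) (ω : Ω) : ℝ :=
  ∑ t ∈ Finset.range T, ∑ i : Fin m, ∑ z,
    max (|stdResidual σn k (history f ε x t ω) (g t ω i) z| - β) 0

namespace IsRun

variable {Ω X 𝒰 : Type*} [MeasurableSpace Ω] [Fintype X] [DecidableEq X] [MeasurableSpace X]
  [MeasurableSpace 𝒰] {P : Measure Ω} [IsProbabilityMeasure P]
  {σn : ℝ} {k : X → X → ℝ} {m : ℕ} {f : Ω → X → ℝ} {ε : Ω → ℕ → Fin m → ℝ} {U : Ω → 𝒰}
  {g : ℕ → Ω → Fin m → X → ℝ} {x : ℕ → Ω → Fin m → X}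

/-- Each slot contributes its standard deviation times one factor common to all slots, which
therefore comes out of the sum. The random `ρ` multiplies only `β`; the excess gets the
deterministic bound on `ρ`. -/
theorem iSup_draw_sub_postMean_le [Nonempty X] (h : IsRun P σn k m f ε U g x)
    (hk : (Matrix.of k).PosSemidef) (hσn : 0 < σn) (hk_le : ∀ z z', k z z' ≤ 1)
    (hk_pos : ∀ z, 0 < k z z) {T : ℕ} (hT : 1 ≤ T) {β : ℝ} (hβ : 0 ≤ β) :
    ∀ᵐ ω ∂P, ∑ t ∈ Finset.range T, ∑ i : Fin m, ((⨆ z, g t ω i z) -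
        postMean σn k (design x t ω) (observed f ε x t ω) (x t ω i)) ≤
      √(2 * (1 + σn ^ 2)) * √((T * m : ℕ) * maxInfoGain σn k (T * m)) *
        (rhoPath σn k x T ω * β + √(1 + m / σn ^ 2) * excess σn k f ε g x β T ω) := by
  have hae : ∀ᵐ ω ∂P, ∀ t, ∀ i, ∀ z : X,
      rsr σn k f ε g x t i ω (x t ω i) ≤ rsr σn k f ε g x t i ω z :=
    ae_all_iff.2 fun t => ae_all_iff.2 fun i => h.argmin t i
  filter_upwards [hae] with ω hω
  set Y := rhoPath σn k x T ω * β + √(1 + m / σn ^ 2) * excess σn k f ε g x β T ω with hY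
  have hρ0 : 0 ≤ rhoPath σn k x T ω :=
    zero_le_one.trans (one_le_rhoPath hk hσn hk_le hk_pos x hT ω)
  have hpos : ∀ t i, 0 ≤ ∑ z, max (|stdResidual σn k (history f ε x t ω) (g t ω i) z| - β) 0 :=
    fun t i => Finset.sum_nonneg fun z _ => le_max_right _ _
  have hexc : 0 ≤ excess σn k f ε g x β T ω :=
    Finset.sum_nonneg fun t _ => Finset.sum_nonneg fun i _ => hpos t i
  have hY0 : 0 ≤ Y := by positivity
  have hle : ∀ t ∈ Finset.range T, ∀ i : Fin m, (⨆ z, g t ω i z) -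
      postMean σn k (design x t ω) (observed f ε x t ω) (x t ω i) ≤
      postSdGiven σn k (fun p : Fin t × Fin m => x p.1 ω p.2)
        (fun j : {j : Fin m // j < i} => x t ω j) (x t ω i) * Y := fun t ht i => by
    have h1 := sup_sub_le_of_argmin (β := β) (v := g t ω i) (y := x t ω i)
      (μ := postMean σn k (design x t ω) (observed f ε x t ω))
      (s := postSd σn k (design x t ω))
      (sd := postSdGiven σn k (design x t ω) fun j : {j : Fin m // j < i} => x t ω j)
      (fun z => postSd_pos hk hσn _ (hk_pos z)) (fun z => postSd_pos hk hσn _ (hk_pos z))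
      (fun z => postSd_div_postSdGiven_le_rhoPath hk hσn hk_le hk_pos x (Finset.mem_range.1 ht)
        ω i z) (hω t i)
    refine h1.trans (mul_le_mul_of_nonneg_left ?_ (postSd_pos hk hσn _ (hk_pos _)).le)
    rw [mul_add]
    refine add_le_add_right (mul_le_mul (rhoPath_le hk hσn hk_le hk_pos x T ω) ?_ (hpos t i)
      (Real.sqrt_nonneg _)) _
    exact (Finset.single_le_sum (f := fun i => ∑ z,
        max (|stdResidual σn k (history f ε x t ω) (g t ω i) z| - β) 0)
      (fun i _ => hpos t i) (Finset.mem_univ i)).trans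
      (Finset.single_le_sum (f := fun t => ∑ i, ∑ z,
        max (|stdResidual σn k (history f ε x t ω) (g t ω i) z| - β) 0)
        (fun t _ => Finset.sum_nonneg fun i _ => hpos t i) ht)
  refine (Finset.sum_le_sum fun t ht => Finset.sum_le_sum fun i _ => hle t ht i).trans ?_
  simp_rw [← Finset.sum_mul]
  exact mul_le_mul_of_nonneg_right
    (sum_postSdGiven_le hk hσn hk_le hk_pos (fun t => x t ω) T) hY0

variable [DiscreteMeasurableSpace X]

theorem measurable_stdResidual_draw (h : IsRun P σn k m f ε U g x)
    (hk : (Matrix.of k).PosSemidef) (hσn : 0 < σn) (t : ℕ) (i : Fin m) (z : X) :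
    Measurable fun ω => stdResidual σn k (history f ε x t ω) (g t ω i) z :=
  (measurable_stdResidual hk hσn z).comp
    ((h.measurable_history t).prodMk (h.measurable_draw t i))

theorem integrable_max_stdResidual (h : IsRun P σn k m f ε U g x) (hk : (Matrix.of k).PosSemidef)
    (hσn : 0 < σn) (hk_pos : ∀ z, 0 < k z z) {β : ℝ} (hβ : 0 < β) (t : ℕ) (i : Fin m) (z : X) :
    Integrable (fun ω => max (|stdResidual σn k (history f ε x t ω) (g t ω i) z| - β) 0) P := by
  have h1 := integrable_max_abs_sub hβ
  rw [← h.map_stdResidual_draw hk hσn hk_pos t i z] at h1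
  exact (integrable_map_measure (by fun_prop)
    (h.measurable_stdResidual_draw hk hσn t i z).aemeasurable).1 h1

theorem integral_max_stdResidual_le (h : IsRun P σn k m f ε U g x) (hk : (Matrix.of k).PosSemidef)
    (hσn : 0 < σn) (hk_pos : ∀ z, 0 < k z z) {β : ℝ} (hβ : 0 < β) (t : ℕ) (i : Fin m) (z : X) :
    ∫ ω, max (|stdResidual σn k (history f ε x t ω) (g t ω i) z| - β) 0 ∂P ≤
      2 / β * Real.exp (-(β ^ 2 / 2)) := by
  have h1 := integral_max_abs_sub_le hβ
  rw [← h.map_stdResidual_draw hk hσn hk_pos t i z,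
    integral_map (h.measurable_stdResidual_draw hk hσn t i z).aemeasurable (by fun_prop)] at h1
  exact h1

theorem integrable_excess (h : IsRun P σn k m f ε U g x) (hk : (Matrix.of k).PosSemidef)
    (hσn : 0 < σn) (hk_pos : ∀ z, 0 < k z z) {β : ℝ} (hβ : 0 < β) (T : ℕ) :
    Integrable (excess σn k f ε g x β T) P :=
  integrable_finsetSum _ fun t _ => integrable_finsetSum _ fun i _ =>
    integrable_finsetSum _ fun z _ => h.integrable_max_stdResidual hk hσn hk_pos hβ t i z

theorem integral_excess_le (h : IsRun P σn k m f ε U g x) (hk : (Matrix.of k).PosSemidef)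
    (hσn : 0 < σn) (hk_pos : ∀ z, 0 < k z z) {β : ℝ} (hβ : 0 < β) (T : ℕ) :
    ∫ ω, excess σn k f ε g x β T ω ∂P ≤
      (T * m : ℕ) * (Fintype.card X * (2 / β * Real.exp (-(β ^ 2 / 2)))) := by
  have hI := h.integrable_max_stdResidual hk hσn hk_pos hβ
  unfold excess
  rw [integral_finsetSum _ fun t _ => integrable_finsetSum _ fun i _ =>
    integrable_finsetSum _ fun z _ => hI t i z]
  have : ∀ t ∈ Finset.range T, ∫ ω, ∑ i : Fin m, ∑ z,
      max (|stdResidual σn k (history f ε x t ω) (g t ω i) z| - β) 0 ∂P ≤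
      m * (Fintype.card X * (2 / β * Real.exp (-(β ^ 2 / 2)))) := fun t _ => by
    rw [integral_finsetSum _ fun i _ => integrable_finsetSum _ fun z _ => hI t i z]
    have h1 : ∀ i ∈ Finset.univ, ∫ ω, ∑ z,
        max (|stdResidual σn k (history f ε x t ω) (g t ω i) z| - β) 0 ∂P ≤
        Fintype.card X * (2 / β * Real.exp (-(β ^ 2 / 2))) := fun i _ => by
      rw [integral_finsetSum _ fun z _ => hI t i z]
      have := Finset.sum_le_card_nsmul (Finset.univ : Finset X) _ _ fun z _ =>
        h.integral_max_stdResidual_le hk hσn hk_pos hβ t i z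
      simpa using this
    have := Finset.sum_le_card_nsmul Finset.univ _ _ h1
    simpa using this
  have := Finset.sum_le_card_nsmul _ _ _ this
  rw [Finset.card_range, nsmul_eq_mul] at this
  rw [Nat.cast_mul, mul_assoc]
  exact this

/-- The excess bound at the level `β = √(2 log (D n³))`. -/
theorem integral_rhoPath_add_excess_le [Nonempty X] (h : IsRun P σn k m f ε U g x)
    (hk : (Matrix.of k).PosSemidef) (hσn : 0 < σn) (hk_le : ∀ z z', k z z' ≤ 1)
    (hk_pos : ∀ z, 0 < k z z) (hD : 2 ≤ Fintype.card X) (hm : 1 ≤ m) {T : ℕ} (hT : 1 ≤ T)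
    {L : ℝ} (hL : L = Real.log (Fintype.card X * ((T * m : ℕ) : ℝ) ^ 3)) :
    ∫ ω, (rhoPath σn k x T ω * √(2 * L) +
        √(1 + m / σn ^ 2) * excess σn k f ε g x √(2 * L) T ω) ∂P ≤
      (√2 + 4 * √(1 + 1 / σn ^ 2)) * ((∫ ω, rhoPath σn k x T ω ∂P) * √L) := by
  set D : ℝ := (Fintype.card X : ℝ) with hDdef
  set n : ℝ := ((T * m : ℕ) : ℝ) with hn
  have hD2 : (2 : ℝ) ≤ D := by rw [hDdef]; exact_mod_cast hD
  have hmn : (m : ℝ) ≤ n := by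
    rw [hn]; exact_mod_cast Nat.le_mul_of_pos_left m hT
  have hm1 : (1 : ℝ) ≤ m := by exact_mod_cast hm
  have hn1 : 1 ≤ n := hm1.trans hmn
  have hn3 : 1 ≤ n ^ 3 := one_le_pow₀ hn1
  have hDn : 2 ≤ D * n ^ 3 := by nlinarith
  have hLhalf : 1 / 2 ≤ L := by
    rw [hL]
    -- Here `D ≥ 2` enters: `log 2 > 1/2` gives `L ≥ 1/2`, hence `β ≥ 1` and `√L ≥ 1/2`.
    have := Real.log_le_log two_pos hDn
    linarith [Real.log_two_gt_d9]
  set β := √(2 * L) with hβdef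
  have hβ1 : 1 ≤ β := Real.one_le_sqrt.2 (by linarith)
  have hβ0 : 0 < β := by linarith
  have hρ := h.integrable_rhoPath hk hσn hk_le hk_pos hT
  have hexc := h.integrable_excess hk hσn hk_pos hβ0 T
  rw [integral_add (hρ.mul_const _) (hexc.const_mul _), integral_mul_const, integral_const_mul]
  have hE1 : 1 ≤ ∫ ω, rhoPath σn k x T ω ∂P := by
    have := integral_mono (μ := P) (integrable_const (1 : ℝ)) hρ
      fun ω => one_le_rhoPath hk hσn hk_le hk_pos x hT ω
    simpa using this
  have hexp : Real.exp (-(β ^ 2 / 2)) = 1 / (D * n ^ 3) := by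
    rw [hβdef, Real.sq_sqrt (by linarith), mul_div_cancel_left₀ _ two_ne_zero, Real.exp_neg, hL,
      Real.exp_log (by linarith), one_div]
  have h1 := h.integral_excess_le hk hσn hk_pos hβ0 T
  rw [hexp] at h1
  -- The cube in the logarithm: `n D` tail terms of size `1 / (D n³)` leave at most `2 / n`, enough
  -- to cancel the factor `n` in `hc`.
  have h2 : n * (D * (2 / β * (1 / (D * n ^ 3)))) ≤ 2 / n := by
    have hD0 : D ≠ 0 := by linarith
    have hn0 : n ≠ 0 := by linarith
    have : n * (D * (2 / β * (1 / (D * n ^ 3)))) = 2 / (β * n ^ 2) := by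
      field_simp
    rw [this]
    refine div_le_div_of_nonneg_left two_pos.le (by linarith) ?_
    nlinarith
  have hc : √(1 + m / σn ^ 2) ≤ n * √(1 + 1 / σn ^ 2) := by
    rw [← Real.sqrt_sq (zero_le_one.trans hn1), ← Real.sqrt_mul (sq_nonneg n)]
    refine Real.sqrt_le_sqrt ?_
    have hsq : n ≤ n ^ 2 := by nlinarith
    rw [mul_add, mul_one, mul_one_div]
    exact add_le_add (by linarith) (by gcongr; linarith)
  have h3 : √(1 + m / σn ^ 2) * ∫ ω, excess σn k f ε g x β T ω ∂P ≤
      2 * √(1 + 1 / σn ^ 2) := by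
    have hn0 : 0 < n := by linarith
    calc √(1 + m / σn ^ 2) * ∫ ω, excess σn k f ε g x β T ω ∂P
        ≤ √(1 + m / σn ^ 2) * (2 / n) :=
          mul_le_mul_of_nonneg_left (h1.trans h2) (Real.sqrt_nonneg _)
      _ ≤ n * √(1 + 1 / σn ^ 2) * (2 / n) := mul_le_mul_of_nonneg_right hc (by positivity)
      _ = 2 * √(1 + 1 / σn ^ 2) := by field_simp
  have hsL : 1 / 2 ≤ √L := Real.le_sqrt_of_sq_le (by linarith)
  -- Since `E[ρ] √L ≥ 1/2`, the leftover constant `2 √(1 + 1/σₙ²)` is at most `4 √(1 + 1/σₙ²)` times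
  -- `E[ρ] √L`.
  have h4 : 1 / 2 ≤ (∫ ω, rhoPath σn k x T ω ∂P) * √L := by nlinarith
  have h5 : β = √2 * √L := Real.sqrt_mul zero_le_two L
  have h6 := mul_le_mul_of_nonneg_left h4 (Real.sqrt_nonneg (1 + 1 / σn ^ 2))
  rw [h5] at h3 ⊢
  linarith

theorem integral_regret_le [Nonempty X] (h : IsRun P σn k m f ε U g x)
    (hk : (Matrix.of k).PosSemidef) (hσn : 0 < σn) (hk_le : ∀ z z', k z z' ≤ 1)
    (hk_pos : ∀ z, 0 < k z z) (hD : 2 ≤ Fintype.card X) (hm : 1 ≤ m) {T : ℕ} (hT : 1 ≤ T) :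
    ∫ ω, regret f x T ω ∂P ≤ √(2 * (1 + σn ^ 2)) * (√2 + 4 * √(1 + 1 / σn ^ 2)) *
      ((∫ ω, rhoPath σn k x T ω ∂P) * √((T * m : ℕ) * maxInfoGain σn k (T * m)) *
        √(Real.log (Fintype.card X * ((T * m : ℕ) : ℝ) ^ 3))) := by
  have h1 := h.integral_rhoPath_add_excess_le hk hσn hk_le hk_pos hD hm hT rfl
  set L := Real.log (Fintype.card X * ((T * m : ℕ) : ℝ) ^ 3) with hL
  have hL0 : 0 < L := by
    refine Real.log_pos ?_
    have : 1 < Fintype.card X * (T * m) ^ 3 :=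
      lt_of_lt_of_le hD (Nat.le_mul_of_pos_right _ (by positivity))
    exact_mod_cast this
  have hβ0 : 0 < √(2 * L) := Real.sqrt_pos.2 (by linarith)
  have hY : Integrable (fun ω => rhoPath σn k x T ω * √(2 * L) +
      √(1 + m / σn ^ 2) * excess σn k f ε g x √(2 * L) T ω) P :=
    ((h.integrable_rhoPath hk hσn hk_le hk_pos hT).mul_const _).add
      ((h.integrable_excess hk hσn hk_pos hβ0 T).const_mul _)
  rw [h.integral_regret_eq hk hσn T]
  refine (integral_mono_ae (integrable_finsetSum _ fun t _ => integrable_finsetSum _ fun i _ =>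
    h.integrable_iSup_draw_sub_postMean hk hσn t i) (hY.const_mul _)
    (h.iSup_draw_sub_postMean_le hk hσn hk_le hk_pos hT hβ0.le)).trans ?_
  rw [integral_const_mul]
  refine (mul_le_mul_of_nonneg_left h1 (by positivity)).trans (le_of_eq ?_)
  ring

end IsRun

end

end BatchTS

theorem mainTheorem1 (σn : ℝ) (hσn : 0 < σn) :
    ∃ C : ℝ, 0 < C ∧
      ∀ (X : Type*) [Fintype X] [DecidableEq X] [MeasurableSpace X] [DiscreteMeasurableSpace X]
        (k : X → X → ℝ)
        (_hD : 2 ≤ Fintype.card X)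
        (_hk : (Matrix.of k).PosSemidef)
        (_hk_pos : ∀ z, 0 < k z z)
        (_hk_le : ∀ z z', k z z' ≤ 1)
        (Ω : Type*) [MeasurableSpace Ω] (P : Measure Ω) [IsProbabilityMeasure P]
        (𝒰 : Type*) [MeasurableSpace 𝒰]
        (m : ℕ) (_hm : 1 ≤ m)
        (f : Ω → X → ℝ) (ε : Ω → ℕ → Fin m → ℝ) (U : Ω → 𝒰)
        (g : ℕ → Ω → Fin m → X → ℝ) (x : ℕ → Ω → Fin m → X)
        (_hrun : BatchTS.IsRun P σn k m f ε U g x)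
        (T : ℕ) (_hT : 1 ≤ T),
        Integrable (BatchTS.regret f x T) P ∧
        Integrable (BatchTS.rhoPath σn k x T) P ∧
        ∫ ω, BatchTS.regret f x T ω ∂P ≤
          C * ((∫ ω, BatchTS.rhoPath σn k x T ω ∂P) *
            √((T * m : ℕ) * BatchTS.maxInfoGain σn k (T * m)) *
            √(Real.log (Fintype.card X * ((T * m : ℕ) : ℝ) ^ 3))) ∧
        ∫ ω, BatchTS.regret f x T ω ∂P ≤
          C * (BatchTS.rho σn k T m *
            √((T * m : ℕ) * BatchTS.maxInfoGain σn k (T * m)) *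
            √(Real.log (Fintype.card X * ((T * m : ℕ) : ℝ) ^ 3))) := by
  -- The first factor comes from the information gain bound, `√2` from `β = √2 √L`, and the last
  -- summand from the excess.
  refine ⟨√(2 * (1 + σn ^ 2)) * (√2 + 4 * √(1 + 1 / σn ^ 2)), by positivity, ?_⟩
  intro X _ _ _ _ k hD hk hk_pos hk_le Ω _ P _ 𝒰 _ m hm f ε U g x hrun T hT
  have : Nonempty X := Fintype.card_pos_iff.1 (by omega)
  have hρ := hrun.integrable_rhoPath hk hσn hk_le hk_pos hT
  have hR := hrun.integral_regret_le hk hσn hk_le hk_pos hD hm hT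
  refine ⟨hrun.integrable_regret T, hρ, hR, hR.trans ?_⟩
  have h1 : ∫ ω, BatchTS.rhoPath σn k x T ω ∂P ≤ BatchTS.rho σn k T m := by
    have := integral_mono (μ := P) hρ (integrable_const (BatchTS.rho σn k T m))
      fun ω => BatchTS.rhoPath_le_rho hk hσn hk_le hk_pos x hT ω
    simpa using this
  gcongr
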